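/- For $p\in[0,1]$, consider the growing Barak–Erdős graph with edge probability $p$: the random directed graph on the vertices $1,2,3,\dots$ in which, for each pair $i<j$, the edge $i\to j$ is present with probability $p$, independently for all pairs. Let $L_n(p)$ be the length (number of edges) of the longest directed path in its restriction to $\{1,\dots,n\}$. Let $C(p)$ be the growth rate, that is, the constant such that $L_n(p)/n\to C(p)$ almost surely as $n\to\infty$ (this limit exists for every $p\in[0,1]$). A configuration of balls in bins is a map $X:\mathbb Z\to\{0,1,2,\dots\}\cup\{\infty\}$, where $X(j)$ is the number of balls in bin $j$. It is called admissible if there is $m\in\mathbb Z$ such that $X(j)\neq 0$ if and only if $j\le m$. For an integer $\xi\ge1$, the move $\Phi_\xi$ adds one ball to the bin of index $B(X,\xi)=\inf\{j\in\mathbb Z:\sum_{i\ge j}X(i)<\xi\}$, i.e. to the bin just to the right of the bin containing the $\xi$-th ball of $X$, balls being counted from right to left. A word is a finite sequence $\alpha=(\alpha_1,\dots,\alpha_l)$ of positive integers; its length is $L(\alpha)=l$ and its height is $H(\alpha)=\sum_{i=1}^{l}\alpha_i-l$. Let $\mathcal P_X$ be the set of non-empty words $\alpha$ such that, when the moves $\Phi_{\alpha_1},\dots,\Phi_{\alpha_l}$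 are applied successively starting from $X$, the last move places a ball in a previously empty bin. Put $\epsilon_X(\alpha)=\mathbf 1_{\{\alpha\in\mathcal P_X\}}-\mathbf 1_{\{\varpi\alpha\in\mathcal P_X\}}$, where $\varpi\alpha$ is $\alpha$ with its first letter removed ($\varpi\emptyset=\emptyset$). For $k\ge0$ define the integer $$a_k=\sum_{\alpha:\ H(\alpha)\le k,\ L(\alpha)\le k+1}\epsilon_X(\alpha)\,(-1)^{k-H(\alpha)}\binom{L(\alpha)}{k-H(\alpha)},$$ which is a finite sum. Theorem. The function $C$ is real-analytic on $\left(\tfrac12,1\right]$ (at the endpoint $1$, in the one-sided sense: near $1$, for $p\le 1$, $C$ is the sum of a convergent power series centred at $1$). Moreover, for every admissible configuration $X$ and every $p\in\left(\tfrac{3-\sqrt2}{2},1\right]$, $$C(p)=\sum_{k\ge0}a_k(1-p)^k .$$ -/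

import Mathlib

open MeasureTheory ProbabilityTheory Filter Topology

/-! ### Barak–Erdős graphs -/

namespace BarakErdos

/-- A directed graph on the vertex set `ℕ` all of whose edges are increasing: each pair `i < j`
is declared to be an edge (`true`) or not (`false`). -/
abbrev Graph : Type := {e : ℕ × ℕ // e.1 < e.2} → Bool

/-- `G.Edge i j`: there is an edge directed from `i` to `j`. -/
def Graph.Edge (G : Graph) (i j : ℕ) : Prop :=
  ∃ h : i < j, G ⟨(i, j), h⟩ = true

/-- The law of the growing Barak–Erdős graph with edge probability `p`: every pair `i < j` is an
edge with probability `p`, independently. Its restriction to the first `n` vertices is the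
Barak–Erdős graph of size `n`. -/
noncomputable def law (p : unitInterval) : Measure Graph :=
  Measure.infinitePi fun _ => bernoulliMeasure true false p

instance isProbabilityMeasure_law (p : unitInterval) : IsProbabilityMeasure (law p) := by
  unfold law
  infer_instance

/-- `G.HasPath n k`: the restriction of `G` to the first `n` vertices `0, …, n - 1` has a directed
path of length `k`, i.e. with `k` edges. -/
def Graph.HasPath (G : Graph) (n k : ℕ) : Prop :=
  ∃ v : Fin (k + 1) → Fin n, ∀ i : Fin k, G.Edge (v i.castSucc) (v i.succ)

/-- The length of the longest path in the restriction of `G` to its first `n` vertices. -/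
noncomputable def Graph.longestPath (G : Graph) (n : ℕ) : ℕ :=
  sSup {k | G.HasPath n k}

/-- The supremum defining the longest path is that of a bounded set. -/
theorem Graph.HasPath.lt {G : Graph} {n k : ℕ} (h : G.HasPath n k) : k < n := by
  obtain ⟨v, hv⟩ := h
  have hm : StrictMono v := Fin.strictMono_iff_lt_succ.2 fun i => (hv i).1
  have := Fintype.card_le_of_injective v hm.injective
  simp only [Fintype.card_fin] at this
  omega

theorem Graph.bddAbove_hasPath (G : Graph) (n : ℕ) : BddAbove {k | G.HasPath n k} :=
  ⟨n, fun _ hk => le_of_lt (Graph.HasPath.lt hk)⟩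

end BarakErdos

/-! ### The infinite-bin model -/

namespace InfiniteBin

/-- A configuration of balls in bins indexed by `ℤ`; a bin may hold infinitely many balls. -/
abbrev Config : Type := ℤ → ℕ∞

/-- A configuration is admissible if, for some `m`, the non-empty bins are exactly those of
index at most `m`. -/
def Admissible (X : Config) : Prop :=
  ∃ m : ℤ, ∀ j : ℤ, X j ≠ 0 ↔ j ≤ m

/-- The number of balls in the bins of index at least `k`. -/
noncomputable def ballsFrom (X : Config) (k : ℤ) : ℕ∞ :=
  ∑' j : Set.Ici k, X j

/-- The sum defining `ballsFrom` is always meaningful. -/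
theorem summable_enat {ι : Type*} (f : ι → ℕ∞) : Summable f :=
  ⟨_, hasSum_of_isLUB_of_nonneg _ (fun _ => zero_le) isLUB_iSup⟩

/-- The leftmost position such that there are fewer than `ξ` balls in the bins from there on.
It is `b + 1`, where `b` is the index of the bin containing the `ξ`-th ball, the balls being
counted from right to left. -/
noncomputable def target (X : Config) (ξ : ℕ+) : ℤ :=
  sInf {j : ℤ | ballsFrom X j < ((ξ : ℕ) : ℕ∞)}

/-- For an admissible configuration, the infimum defining `target` is that of a non-empty set
that is bounded below. -/
theorem Admissible.target_aux {X : Config} (hX : Admissible X) (ξ : ℕ+) :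
    {j : ℤ | ballsFrom X j < ((ξ : ℕ) : ℕ∞)}.Nonempty ∧
      BddBelow {j : ℤ | ballsFrom X j < ((ξ : ℕ) : ℕ∞)} := by
  obtain ⟨m, hm⟩ := hX
  constructor
  · refine ⟨m + 1, ?_⟩
    have h0 : ballsFrom X (m + 1) = 0 := by
      unfold ballsFrom
      convert tsum_zero with j
      by_contra h
      have h1 := (hm _).1 h
      have h2 := Set.mem_Ici.1 j.2
      omega
    simp [h0]
  · refine ⟨m - (ξ : ℕ), fun j hj => ?_⟩
    by_contra hlt
    push Not at hlt
    have hj' : ballsFrom X j < ((ξ : ℕ) : ℕ∞) := hj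
    refine absurd hj' (not_lt.2 ?_)
    have e : Function.Injective (fun i : Fin ξ => (⟨j + (i : ℕ), by simp⟩ : Set.Ici j)) := by
      intro a b h
      simp only [Subtype.mk.injEq, add_right_inj, Nat.cast_inj] at h
      exact Fin.ext h
    calc ((ξ : ℕ) : ℕ∞) = ∑ i ∈ (Finset.univ : Finset (Fin ξ)).map ⟨_, e⟩, 1 := by simp
      _ ≤ ∑ i ∈ (Finset.univ : Finset (Fin ξ)).map ⟨_, e⟩, X i := by
        refine Finset.sum_le_sum fun i hi => ?_
        simp only [Finset.mem_map, Finset.mem_univ, true_and] at hi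
        obtain ⟨a, rfl⟩ := hi
        refine Order.one_le_iff_ne_zero.2 ((hm _).2 ?_)
        have := a.2
        simp only [Function.Embedding.coeFn_mk]
        omega
      _ ≤ ballsFrom X j := (summable_enat _).sum_le_tsum _ (fun _ _ => zero_le)

/-- The move of type `ξ`: one ball is added to the bin just to the right of the bin that contains
the `ξ`-th ball. -/
noncomputable def move (ξ : ℕ+) (X : Config) : Config :=
  fun j => X j + if j = target X ξ then 1 else 0

/-- The configuration obtained from `X` by applying successively the moves given by the letters
of a word, from the first letter to the last. -/
noncomputable def applyWord (X : Config) (α : List ℕ+) : Config :=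
  α.foldl (fun Y ξ => move ξ Y) X

/-- The set of non-empty words whose last move, when the word is run from `X`, places a ball in
a previously empty bin. -/
def frontWords (X : Config) : Set (List ℕ+) :=
  {α | ∃ (β : List ℕ+) (ξ : ℕ+), α = β ++ [ξ] ∧ applyWord X β (target (applyWord X β) ξ) = 0}

open scoped Classical in
/-- The sign `ε_X(α) ∈ {-1, 0, 1}` of a word: the indicator that `α` belongs to `frontWords X`
minus the indicator that `α` without its first letter does. -/
noncomputable def sign (X : Config) (α : List ℕ+) : ℤ :=
  (if α ∈ frontWords X then 1 else 0) - (if α.tail ∈ frontWords X then 1 else 0)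

/-- The height of a word: the sum of its letters minus its length. -/
def height (α : List ℕ+) : ℕ :=
  (α.map fun a : ℕ+ => (a : ℕ)).sum - α.length

/-- The subtraction in `height` does not truncate. -/
theorem length_add_height (α : List ℕ+) :
    α.length + height α = (α.map fun a : ℕ+ => (a : ℕ)).sum := by
  have h : α.length ≤ (α.map fun a : ℕ+ => (a : ℕ)).sum := by
    induction α with
    | nil => simp
    | cons a l ih => have := a.pos; simp only [List.length_cons, List.map_cons, List.sum_cons]; omega
  unfold height
  omega

/-- There are finitely many words of height at most `k` and length at most `k + 1`. -/
theorem finite_words (k : ℕ) :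
    {α : List ℕ+ | height α ≤ k ∧ α.length ≤ k + 1}.Finite := by
  refine ((List.finite_length_le (Set.Iic (2 * k + 1).succPNat) (k + 1)).image
    (List.map Subtype.val)).subset ?_
  rintro α ⟨h1, h2⟩
  have h3 := length_add_height α
  have h4 : ∀ a ∈ α, a ∈ Set.Iic (2 * k + 1).succPNat := by
    intro a ha
    have : (a : ℕ) ≤ (α.map fun a : ℕ+ => (a : ℕ)).sum :=
      List.single_le_sum (by simp) _ (List.mem_map_of_mem ha)
    rw [Set.mem_Iic, ← PNat.coe_le_coe, Nat.succPNat_coe]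
    omega
  lift α to List (Set.Iic (2 * k + 1).succPNat) using h4
  exact ⟨α, by simpa using h2, rfl⟩

/-- The coefficient `a_k`, a finite signed sum of binomial coefficients over the words of height
at most `k` and length at most `k + 1`. -/
noncomputable def coeff (X : Config) (k : ℕ) : ℤ :=
  ∑ α ∈ (finite_words k).toFinset,
    sign X α * (-1) ^ (k - height α) * (Nat.choose α.length (k - height α) : ℤ)

end InfiniteBin

/-!
Adding the vertices of a Barak–Erdős graph one at a time is an infinite-bin model with geometric
moves: put each vertex in the bin whose index is the length of the longest path ending at it. A new
vertex ends a path of length `t + 1` unless all edges to it from the vertices ending a path of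
length `t` are absent, and the chance of this is that of a geometric letter exceeding their number
(`integral_profile`). A configuration enters only through its profile, the tail counts
`N j = ballsFrom X j`, on which a move is `N j ↦ N j + [ξ ≤ N (j - 1)]`; this is visibly monotone and
commutes with translations.

*Existence of the growth rate.* The displacement of the front is a subadditive function of the word,
so its expectation grows linearly by Fekete's lemma. Changing one letter changes it by at most one, so
its variance over `n` letters is at most `n` (`wordAvg_variance_le`), and Chebyshev's inequality
along the squares together with monotonicity gives almost sure convergence. (The longest path itself
is not a Lipschitz function of the edges, which is why the variance is estimated on words.) For
`p = 0` there are no edges.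

*The signed sum.* A word longer than its height has a non-empty suffix whose `i`-th letter is at most
`i + 1`; such a suffix does not see the configuration it starts from
(`frontWord_iff_of_height_lt`). Hence `sign X α` vanishes if the length of `α` exceeds its height by
more than one. For `p > 1 / 2` the remaining words have summable weights `p ^ L * (1 - p) ^ H`
(`summable_short_words`). The sum of the signs over words of length at most `n` telescopes to the
probability that the `n`-th letter moves the front, so by Cesàro's theorem the growth rate is
`signSum X p`, for every admissible `X`.

*Regularity.* The same summability with `|z|` and `|1 - z|` in place of `p` and `1 - p` makes the signed
sum holomorphic near each point of `(1 / 2, 1]`. With the weights `1 + q` and `q`, where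
`q = 1 - p < (√2 - 1) / 2`, it allows the expansion of `p ^ L = (1 - q) ^ L` in powers of `q` and the
interchange of summations.
-/

namespace InfiniteBin

/-! ### Profiles: the infinite-bin model through its tail counts -/

/-- The move of type `ξ` on profiles. The profile of a configuration `X` is `N = ballsFrom X`; the
move adds a ball at `target X ξ`, and `j ≤ target X ξ` exactly when `ξ ≤ N (j - 1)`. -/
def step (ξ : ℕ+) (N : ℤ → ℕ∞) : ℤ → ℕ∞ :=
  fun j => N j + if ((ξ : ℕ) : ℕ∞) ≤ N (j - 1) then 1 else 0

/-- `N` behaves like the tail counts of an admissible configuration with front `m`: it vanishes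
to the right of `m` and drops by at least one at each index up to `m`. -/
structure IsProfile (N : ℤ → ℕ∞) (m : ℤ) : Prop where
  eq_zero : ∀ j, m < j → N j = 0
  succ_le : ∀ j, j ≤ m → N (j + 1) + 1 ≤ N j

theorem IsProfile.antitone {N : ℤ → ℕ∞} {m : ℤ} (h : IsProfile N m) : Antitone N := by
  refine antitone_int_of_succ_le fun j => ?_
  rcases le_or_gt j m with hj | hj
  · exact le_self_add.trans (h.succ_le j hj)
  · rw [h.eq_zero (j + 1) (by omega)]
    exact zero_le

theorem IsProfile.ne_zero_iff {N : ℤ → ℕ∞} {m : ℤ} (h : IsProfile N m) (j : ℤ) :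
    N j ≠ 0 ↔ j ≤ m := by
  refine ⟨fun hj => ?_, fun hj h0 => ?_⟩
  · by_contra hlt
    exact hj (h.eq_zero j (by omega))
  · simpa [h0] using h.succ_le j hj

theorem IsProfile.step {N : ℤ → ℕ∞} {m : ℤ} (h : IsProfile N m) (ξ : ℕ+) :
    IsProfile (step ξ N) (if ((ξ : ℕ) : ℕ∞) ≤ N m then m + 1 else m) := by
  constructor
  · intro j hj
    split_ifs at hj with hξ
    · simp [InfiniteBin.step, h.eq_zero j (by omega), h.eq_zero (j - 1) (by omega)]
    · have : ¬ ((ξ : ℕ) : ℕ∞) ≤ N (j - 1) := fun h' =>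
        hξ (h'.trans (h.antitone (by omega)))
      simp [InfiniteBin.step, h.eq_zero j (by omega), this]
  · intro j hj
    have hanti : N j ≤ N (j - 1) := h.antitone (by omega)
    have hj' : j ≤ m ∨ j = m + 1 ∧ ((ξ : ℕ) : ℕ∞) ≤ N m := by
      split_ifs at hj with hξ
      · rcases le_or_gt j m with h1 | h1
        · exact .inl h1
        · exact .inr ⟨by omega, hξ⟩
      · exact .inl hj
    simp only [InfiniteBin.step, add_sub_cancel_right]
    rcases hj' with h1 | ⟨rfl, h1⟩
    · have h2 := h.succ_le j h1
      by_cases h3 : ((ξ : ℕ) : ℕ∞) ≤ N j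
      · rw [if_pos h3, if_pos (h3.trans hanti)]
        gcongr
      · rw [if_neg h3, add_zero]
        exact h2.trans le_self_add
    · simp [h.eq_zero (m + 1) (by omega), h.eq_zero (m + 1 + 1) (by omega), h1]

theorem ballsFrom_eq_add (X : Config) (k : ℤ) : ballsFrom X k = X k + ballsFrom X (k + 1) := by
  have h : Set.Ici k = {k} ∪ Set.Ici (k + 1) := by
    ext j; simp only [Set.mem_Ici, Set.mem_union, Set.mem_singleton_iff]; omega
  unfold ballsFrom
  rw [h, (summable_enat _).tsum_union_disjoint (by simp) (summable_enat _)]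
  simp

theorem Admissible.isProfile {X : Config} {m : ℤ} (hX : ∀ j : ℤ, X j ≠ 0 ↔ j ≤ m) :
    IsProfile (ballsFrom X) m := by
  constructor
  · intro j hj
    unfold ballsFrom
    convert tsum_zero with i
    by_contra h
    have h1 := (hX _).1 h
    have h2 := Set.mem_Ici.1 i.2
    omega
  · intro j hj
    rw [ballsFrom_eq_add X j, add_comm]
    gcongr
    exact Order.one_le_iff_ne_zero.2 ((hX j).2 hj)

theorem Admissible.target_le_iff {X : Config} (hX : Admissible X) (ξ : ℕ+) (j : ℤ) :
    target X ξ ≤ j ↔ ballsFrom X j < ((ξ : ℕ) : ℕ∞) := by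
  obtain ⟨m, hm⟩ := hX
  have hne := Admissible.target_aux ⟨m, hm⟩ ξ
  constructor
  · intro h
    exact ((Admissible.isProfile hm).antitone h).trans_lt (Int.csInf_mem hne.1 hne.2)
  · intro h
    exact csInf_le hne.2 h

theorem Admissible.ballsFrom_move {X : Config} (hX : Admissible X) (ξ : ℕ+) :
    ballsFrom (move ξ X) = step ξ (ballsFrom X) := by
  funext k
  have h1 : ballsFrom (move ξ X) k
      = ballsFrom X k + ∑' j : Set.Ici k, (if (j : ℤ) = target X ξ then (1 : ℕ∞) else 0) := by
    unfold ballsFrom move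
    exact (summable_enat _).tsum_add (summable_enat _)
  rw [h1, step]
  congr 1
  have h2 : ((ξ : ℕ) : ℕ∞) ≤ ballsFrom X (k - 1) ↔ k ≤ target X ξ := by
    rw [← not_lt, ← hX.target_le_iff]; omega
  simp only [h2]
  split_ifs with h
  · rw [tsum_eq_single (⟨target X ξ, h⟩ : Set.Ici k)]
    · simp
    · intro b hb
      rw [if_neg]
      exact fun h' => hb (Subtype.ext h')
  · convert tsum_zero with j
    rw [if_neg]
    have := Set.mem_Ici.1 j.2
    omega

theorem Admissible.move {X : Config} (hX : Admissible X) (ξ : ℕ+) :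
    Admissible (move ξ X) := by
  obtain ⟨m, hm⟩ := hX
  have hX : Admissible X := ⟨m, hm⟩
  have hP := Admissible.isProfile hm
  have hle : target X ξ ≤ m + 1 := by
    rw [hX.target_le_iff, hP.eq_zero _ (by omega)]
    simp
  refine ⟨max m (target X ξ), fun j => ?_⟩
  have := hm j
  unfold InfiniteBin.move
  by_cases h : j = target X ξ
  · simp [h]
  · simp only [h, if_false, add_zero, this]
    omega

theorem Admissible.apply_target_eq_zero_iff {X : Config} {m : ℤ}
    (hm : ∀ j : ℤ, X j ≠ 0 ↔ j ≤ m) (ξ : ℕ+) :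
    X (target X ξ) = 0 ↔ ((ξ : ℕ) : ℕ∞) ≤ ballsFrom X m := by
  rw [← not_lt, ← Admissible.target_le_iff ⟨m, hm⟩, ← hm, not_not]

/-- Run a word on a profile, from its first letter to its last. -/
def run (N : ℤ → ℕ∞) (α : List ℕ+) : ℤ → ℕ∞ :=
  α.foldl (fun N ξ => step ξ N) N

@[simp] theorem run_nil (N : ℤ → ℕ∞) : run N [] = N := rfl

@[simp] theorem run_cons (N : ℤ → ℕ∞) (ξ : ℕ+) (α : List ℕ+) :
    run N (ξ :: α) = run (step ξ N) α := rfl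

theorem run_append (N : ℤ → ℕ∞) (α β : List ℕ+) : run N (α ++ β) = run (run N α) β :=
  List.foldl_append

theorem Admissible.applyWord {X : Config} (hX : Admissible X) (α : List ℕ+) :
    Admissible (applyWord X α) ∧ ballsFrom (applyWord X α) = run (ballsFrom X) α := by
  induction α generalizing X with
  | nil => exact ⟨hX, rfl⟩
  | cons ξ α ih =>
    obtain ⟨h1, h2⟩ := ih (hX.move ξ)
    refine ⟨h1, ?_⟩
    rw [run_cons, ← hX.ballsFrom_move]
    exact h2

theorem IsProfile.run {N : ℤ → ℕ∞} {m : ℤ} (h : IsProfile N m) (α : List ℕ+) :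
    ∃ k, m ≤ k ∧ k ≤ m + α.length ∧ IsProfile (run N α) k := by
  induction α generalizing N m with
  | nil => exact ⟨m, le_rfl, by simp, h⟩
  | cons ξ α ih =>
    obtain ⟨k, h1, h2, h3⟩ := ih (h.step ξ)
    refine ⟨k, ?_, ?_, h3⟩
    · split_ifs at h1 <;> omega
    · simp only [List.length_cons]; push_cast
      split_ifs at h2 <;> omega

/-- The counterpart of `frontWords` for profiles: the last letter of the word raises the front. -/
def FrontWord (N : ℤ → ℕ∞) (α : List ℕ+) : Prop :=
  ∃ (β : List ℕ+) (ξ : ℕ+), α = β ++ [ξ] ∧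
    ∃ j, run N β j = 0 ∧ ((ξ : ℕ) : ℕ∞) ≤ run N β (j - 1)

theorem IsProfile.exists_iff {N : ℤ → ℕ∞} {m : ℤ} (h : IsProfile N m) (ξ : ℕ+) :
    (∃ j, N j = 0 ∧ ((ξ : ℕ) : ℕ∞) ≤ N (j - 1)) ↔ ((ξ : ℕ) : ℕ∞) ≤ N m := by
  constructor
  · rintro ⟨j, h0, h1⟩
    have : ¬ j ≤ m := fun h' => (h.ne_zero_iff j).2 h' h0
    exact h1.trans (h.antitone (by omega))
  · intro h1
    exact ⟨m + 1, h.eq_zero _ (by omega), by simpa using h1⟩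

theorem not_frontWord_nil (N : ℤ → ℕ∞) : ¬ FrontWord N [] := by
  rintro ⟨β, ξ, h, -⟩
  simp at h

theorem frontWord_append_singleton (N : ℤ → ℕ∞) (β : List ℕ+) (ξ : ℕ+) :
    FrontWord N (β ++ [ξ]) ↔ ∃ j, run N β j = 0 ∧ ((ξ : ℕ) : ℕ∞) ≤ run N β (j - 1) := by
  constructor
  · rintro ⟨β', ξ', h, h'⟩
    obtain ⟨rfl, h2⟩ := List.append_inj' h rfl
    obtain rfl : ξ = ξ' := by simpa using h2
    exact h'
  · exact fun h => ⟨β, ξ, rfl, h⟩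

theorem Admissible.mem_frontWords {X : Config} (hX : Admissible X) (α : List ℕ+) :
    α ∈ frontWords X ↔ FrontWord (ballsFrom X) α := by
  refine exists_congr fun β => exists_congr fun ξ => and_congr_right fun _ => ?_
  obtain ⟨⟨m, hm⟩, h2⟩ := hX.applyWord β
  rw [apply_target_eq_zero_iff hm, ← h2, (Admissible.isProfile hm).exists_iff]

theorem frontWord_append {N : ℤ → ℕ∞} (β : List ℕ+) {γ : List ℕ+} (hγ : γ ≠ []) :
    FrontWord N (β ++ γ) ↔ FrontWord (run N β) γ := by
  obtain ⟨δ, ξ, rfl⟩ := List.eq_nil_or_concat' γ |>.resolve_left hγ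
  rw [← List.append_assoc, frontWord_append_singleton, frontWord_append_singleton, run_append]

/-! ### Words that forget their initial configuration -/

/-- The `i`-th letter, counted from `0`, is at most `d + i + 1`. A word that is good from `d = 0`
only ever asks about balls that it has placed itself or about the front bin it started from. -/
def GoodFrom : ℕ → List ℕ+ → Prop
  | _, [] => True
  | d, a :: γ => (a : ℕ) ≤ d + 1 ∧ GoodFrom (d + 1) γ

theorem GoodFrom.mono {d e : ℕ} (hde : d ≤ e) {γ : List ℕ+} (h : GoodFrom d γ) :
    GoodFrom e γ := by
  induction γ generalizing d e with
  | nil => trivial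
  | cons a γ ih => exact ⟨h.1.trans (by omega), ih (by omega) h.2⟩

/-- If no non-empty suffix is good then the word is at most as long as it is high. The induction
runs from the last letter backwards and keeps track of a `d` from which the word is good: each new
letter `a` turns `d` into `max (a - 1) (d - 1)`, while height minus length changes by `a - 2`. -/
theorem exists_good_suffix_or (α : List ℕ+) :
    (∃ β γ, α = β ++ γ ∧ γ ≠ [] ∧ GoodFrom 0 γ) ∨
      (α.length ≤ height α ∧ ∃ d, GoodFrom d α ∧ α.length + d ≤ height α + 1) := by
  induction α with
  | nil => exact .inr ⟨by simp, 0, trivial, by simp⟩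
  | cons a α ih =>
    rcases ih with ⟨β, γ, rfl, h⟩ | ⟨h1, d, h2, h3⟩
    · exact .inl ⟨a :: β, γ, rfl, h⟩
    · have e1 := length_add_height α
      have e2 := length_add_height (a :: α)
      simp only [List.length_cons, List.map_cons, List.sum_cons] at e2 ⊢
      have hg : GoodFrom (max (a - 1) (d - 1)) (a :: α) :=
        ⟨by omega, h2.mono (by omega)⟩
      rcases Nat.eq_zero_or_pos (max ((a : ℕ) - 1) (d - 1)) with h0 | h0
      · exact .inl ⟨[], a :: α, rfl, by simp, h0 ▸ hg⟩
      · refine .inr ⟨?_, _, hg, ?_⟩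
        · by_contra hlt
          have := a.pos
          omega
        · have := a.pos
          omega

theorem exists_good_suffix {α : List ℕ+} (h : height α < α.length) :
    ∃ β γ, α = β ++ γ ∧ γ ≠ [] ∧ GoodFrom 0 γ := by
  rcases exists_good_suffix_or α with h' | h'
  · exact h'
  · omega

theorem antitone_step {N : ℤ → ℕ∞} (hN : Antitone N) (a : ℕ+) : Antitone (step a N) := by
  intro i j hij
  unfold step
  gcongr ?_ + ?_
  · exact hN hij
  · split_ifs with h1 h2
    · exact le_rfl
    · exact absurd (h1.trans (hN (by omega))) h2
    · simp
    · exact le_rfl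

theorem le_step_of_le {N : ℤ → ℕ∞} (hN : Antitone N) {m : ℤ} {d : ℕ} {a : ℕ+}
    (hm : ((d + 1 : ℕ) : ℕ∞) ≤ N m) (ha : (a : ℕ) ≤ d + 1) :
    ((d + 1 + 1 : ℕ) : ℕ∞) ≤ step a N m := by
  have h1 : ((a : ℕ) : ℕ∞) ≤ N (m - 1) :=
    (show ((a : ℕ) : ℕ∞) ≤ ((d + 1 : ℕ) : ℕ∞) by exact_mod_cast ha).trans
      (hm.trans (hN (by omega)))
  simp only [step, h1, if_true]
  push_cast at hm ⊢
  gcongr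

/-- Running a word that is good from `d` on two profiles that agree, relative to `m` and `m'`, to
the right of these indices: the letters can only tell the profiles apart through their values at
`m` and `m'`, and these stay above the letters. -/
theorem GoodFrom.frontWord_imp {γ : List ℕ+} {d : ℕ} (hγ : GoodFrom d γ) {N N' : ℤ → ℕ∞}
    {m m' : ℤ} (hN : Antitone N) (hN' : Antitone N')
    (hd : ((d + 1 : ℕ) : ℕ∞) ≤ N m) (hd' : ((d + 1 : ℕ) : ℕ∞) ≤ N' m')
    (heq : ∀ i : ℤ, 0 < i → N (m + i) = N' (m' + i)) :
    FrontWord N γ → FrontWord N' γ := by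
  induction γ generalizing d N N' with
  | nil => exact fun h => absurd h (not_frontWord_nil N)
  | cons a γ ih =>
    have key : ∀ i : ℤ, 0 < i →
        (((a : ℕ) : ℕ∞) ≤ N (m + i - 1) ↔ ((a : ℕ) : ℕ∞) ≤ N' (m' + i - 1)) := by
      intro i hi
      rcases eq_or_ne i 1 with rfl | hi1
      · have : ((a : ℕ) : ℕ∞) ≤ ((d + 1 : ℕ) : ℕ∞) := by exact_mod_cast hγ.1
        simp [this.trans hd, this.trans hd']
      · rw [add_sub_assoc, add_sub_assoc, heq _ (by omega)]
    rcases eq_or_ne γ [] with rfl | hne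
    · have e : [a] = [] ++ [a] := rfl
      rw [e, frontWord_append_singleton, frontWord_append_singleton]
      rintro ⟨j, h0, h1⟩
      simp only [run_nil] at h0 h1 ⊢
      have hj : 0 < j - m := by
        by_contra hlt
        have : N m ≤ N j := hN (by omega)
        rw [h0] at this
        have := hd.trans this
        simp at this
      refine ⟨m' + (j - m), ?_, ?_⟩
      · rw [← heq _ hj, ← h0]; congr 1; omega
      · rw [← key _ hj]; convert h1 using 2; omega
    · have e : a :: γ = [a] ++ γ := rfl
      rw [e, frontWord_append _ hne, frontWord_append _ hne]
      simp only [run_cons, run_nil]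
      refine ih (d := d + 1) hγ.2 (antitone_step hN a) (antitone_step hN' a)
        (le_step_of_le hN hd hγ.1) (le_step_of_le hN' hd' hγ.1) fun i hi => ?_
      simp only [step, key i hi, heq i hi]

/-- A word longer than its height has a good suffix, so whether it raises the front last does not
depend on the initial configuration. -/
theorem frontWord_iff_of_height_lt {N N' : ℤ → ℕ∞} {m m' : ℤ} (hN : IsProfile N m)
    (hN' : IsProfile N' m') {α : List ℕ+} (h : height α < α.length) :
    FrontWord N α ↔ FrontWord N' α := by
  obtain ⟨β, γ, rfl, hne, hγ⟩ := exists_good_suffix h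
  rw [frontWord_append _ hne, frontWord_append _ hne]
  obtain ⟨k, -, -, hk⟩ := hN.run β
  obtain ⟨k', -, -, hk'⟩ := hN'.run β
  have h1 : ((0 + 1 : ℕ) : ℕ∞) ≤ run N β k := by
    simpa using Order.one_le_iff_ne_zero.2 ((hk.ne_zero_iff k).2 le_rfl)
  have h2 : ((0 + 1 : ℕ) : ℕ∞) ≤ run N' β k' := by
    simpa using Order.one_le_iff_ne_zero.2 ((hk'.ne_zero_iff k').2 le_rfl)
  have h3 : ∀ i : ℤ, 0 < i → run N β (k + i) = run N' β (k' + i) := fun i hi => by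
    rw [hk.eq_zero _ (by omega), hk'.eq_zero _ (by omega)]
  exact ⟨hγ.frontWord_imp hk.antitone hk'.antitone h1 h2 h3,
    hγ.frontWord_imp hk'.antitone hk.antitone h2 h1 fun i hi => (h3 i hi).symm⟩

/-- For long words the first letter only changes the configuration from which the rest is run,
and the rest forgets it. -/
theorem sign_eq_zero {X : Config} (hX : Admissible X) {α : List ℕ+}
    (h : height α + 1 < α.length) : sign X α = 0 := by
  cases α with
  | nil => simp at h
  | cons a α =>
    have e1 := length_add_height α
    have e2 := length_add_height (a :: α)
    simp only [List.length_cons, List.map_cons, List.sum_cons] at e2 h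
    have ha := a.pos
    obtain ⟨m, hm⟩ := id hX
    have hP := Admissible.isProfile hm
    have key : (a :: α) ∈ frontWords X ↔ α ∈ frontWords X := by
      rw [hX.mem_frontWords, hX.mem_frontWords]
      have e : a :: α = [a] ++ α := rfl
      have hne : α ≠ [] := by
        rintro rfl
        simp at h
      rw [e, frontWord_append _ hne]
      exact frontWord_iff_of_height_lt (hP.step a) hP (by omega)
    by_cases hα : α ∈ frontWords X <;> simp [sign, key, hα]

theorem abs_sign_le_one (X : Config) (α : List ℕ+) : |sign X α| ≤ 1 := by
  unfold sign
  split_ifs <;> simp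

/-! ### Monotonicity and the displacement of the front -/

theorem step_mono {N N' : ℤ → ℕ∞} (h : N ≤ N') (ξ : ℕ+) : step ξ N ≤ step ξ N' := by
  intro j
  unfold step
  gcongr ?_ + ?_
  · exact h j
  · split_ifs with h1 h2
    · exact le_rfl
    · exact absurd (h1.trans (h _)) h2
    · simp
    · exact le_rfl

theorem run_mono {N N' : ℤ → ℕ∞} (h : N ≤ N') (α : List ℕ+) : run N α ≤ run N' α := by
  induction α generalizing N N' with
  | nil => exact h
  | cons ξ α ih => exact ih (step_mono h ξ)

/-- The profile translated by `k` to the right. -/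
def shift (k : ℤ) (N : ℤ → ℕ∞) : ℤ → ℕ∞ := fun j => N (j - k)

theorem run_shift (k : ℤ) (N : ℤ → ℕ∞) (α : List ℕ+) :
    run (shift k N) α = shift k (run N α) := by
  induction α generalizing N with
  | nil => rfl
  | cons ξ α ih =>
    rw [run_cons, run_cons, ← ih]
    congr 1
    funext j
    have e : shift k N (j - 1) = N (j - k - 1) := congrArg N (by ring)
    simp only [step, e]
    rfl

theorem le_step (ξ : ℕ+) (N : ℤ → ℕ∞) : N ≤ step ξ N := fun _ => le_self_add

theorem IsProfile.step_le_shift {N : ℤ → ℕ∞} {m : ℤ} (h : IsProfile N m) (ξ : ℕ+) :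
    InfiniteBin.step ξ N ≤ shift 1 N := by
  intro j
  simp only [InfiniteBin.step, shift]
  rcases le_or_gt (j - 1) m with hj | hj
  · have := h.succ_le (j - 1) hj
    rw [sub_add_cancel] at this
    refine le_trans ?_ this
    gcongr
    split_ifs <;> simp
  · simp [h.eq_zero j (by omega), h.eq_zero (j - 1) hj]

theorem IsProfile.shift {N : ℤ → ℕ∞} {m : ℤ} (h : IsProfile N m) (k : ℤ) :
    IsProfile (shift k N) (m + k) := by
  constructor
  · exact fun j hj => h.eq_zero _ (by omega)
  · intro j hj
    have := h.succ_le (j - k) (by omega)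
    simpa only [InfiniteBin.shift, show j + 1 - k = j - k + 1 by ring] using this

theorem IsProfile.le_of_le {N N' : ℤ → ℕ∞} {m m' : ℤ} (h : IsProfile N m) (h' : IsProfile N' m')
    (hle : N ≤ N') : m ≤ m' := by
  rw [← h'.ne_zero_iff]
  intro h0
  exact (h.ne_zero_iff m).2 le_rfl (le_antisymm ((hle m).trans h0.le) zero_le)

theorem IsProfile.unique {N : ℤ → ℕ∞} {m m' : ℤ} (h : IsProfile N m) (h' : IsProfile N m') :
    m = m' := le_antisymm (h.le_of_le h' le_rfl) (h'.le_of_le h le_rfl)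

/-- Infinitely many balls in each bin of negative index and none elsewhere. It dominates every
configuration with front `-1`, and equals its own profile. -/
noncomputable def halfLine : Config := fun j => if j < 0 then ⊤ else 0

theorem halfLine_ne_zero_iff (j : ℤ) : halfLine j ≠ 0 ↔ j ≤ -1 := by
  unfold halfLine
  split_ifs with h <;> simp <;> omega

theorem admissible_halfLine : Admissible halfLine := ⟨-1, halfLine_ne_zero_iff⟩

theorem ballsFrom_halfLine : ballsFrom halfLine = halfLine := by
  funext j
  have h := Admissible.isProfile halfLine_ne_zero_iff
  by_cases hj : j < 0
  · rw [ballsFrom_eq_add]; simp [halfLine, hj]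
  · rw [h.eq_zero j (by omega)]; simp [halfLine, hj]

theorem isProfile_halfLine : IsProfile halfLine (-1) :=
  ballsFrom_halfLine ▸ Admissible.isProfile halfLine_ne_zero_iff

/-- The number of non-negative indices at which a profile does not vanish, for a profile whose
front is at least `-1`. -/
noncomputable def levelCount (N : ℤ → ℕ∞) : ℕ := sInf {n : ℕ | N n = 0}

/-- The displacement of the front when a word is run from `halfLine`, that is, the number of
letters of the word that place a ball in an empty bin. -/
noncomputable def frontCount (α : List ℕ+) : ℕ := levelCount (run halfLine α)

theorem isProfile_run (α : List ℕ+) :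
    IsProfile (run halfLine α) ((frontCount α : ℤ) - 1) ∧ frontCount α ≤ α.length := by
  obtain ⟨k, h1, h2, h3⟩ := isProfile_halfLine.run α
  have : frontCount α = k + 1 := by
    have e : {n : ℕ | run halfLine α n = 0} = Set.Ici (k + 1).toNat := by
      ext n
      have := h3.ne_zero_iff n
      rw [Set.mem_ofPred_eq, Set.mem_Ici, ← not_iff_not, ← ne_eq, this]
      omega
    rw [frontCount, levelCount, e, csInf_Ici]
    omega
  refine ⟨?_, by omega⟩
  rwa [this, add_sub_cancel_right]

theorem frontCount_eq {α : List ℕ+} {m : ℤ} (h : IsProfile (run halfLine α) m) :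
    (frontCount α : ℤ) = m + 1 := by
  have := h.unique (isProfile_run α).1
  omega

theorem frontCount_nil : frontCount [] = 0 := by
  simpa using frontCount_eq (α := []) isProfile_halfLine

open scoped Classical in
theorem frontCount_append_singleton (α : List ℕ+) (ξ : ℕ+) :
    frontCount (α ++ [ξ]) = frontCount α + if FrontWord halfLine (α ++ [ξ]) then 1 else 0 := by
  have h := (isProfile_run α).1
  have h2 := h.step ξ
  have := frontCount_eq (α := α ++ [ξ]) (by rw [run_append]; exact h2)
  rw [frontWord_append_singleton, h.exists_iff]
  split_ifs at this ⊢ <;> omega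

/-- After `α`, the profile lies below a translate of `halfLine`. -/
theorem frontCount_append_le (α β : List ℕ+) :
    frontCount (α ++ β) ≤ frontCount α + frontCount β := by
  have h := (isProfile_run α).1
  have hle : run halfLine α ≤ shift (frontCount α) halfLine := by
    intro j
    by_cases hj : j - frontCount α < 0
    · simp [shift, halfLine, hj]
    · rw [h.eq_zero j (by omega)]; exact zero_le
  have h1 := run_mono hle β
  rw [← run_append, run_shift] at h1
  have := (isProfile_run (α ++ β)).1.le_of_le ((isProfile_run β).1.shift _) h1
  omega

/-- Skipping a letter and playing any letter differ by at most a translation by one, so changing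
one letter changes the displacement of the front by at most one. -/
theorem frontCount_replace (β γ : List ℕ+) (ξ η : ℕ+) :
    frontCount (β ++ ξ :: γ) ≤ frontCount (β ++ η :: γ) + 1 := by
  have h := (isProfile_run β).1
  have h1 : run (run halfLine β) γ ≤ run halfLine (β ++ η :: γ) := by
    rw [run_append, run_cons]
    exact run_mono (le_step _ _) γ
  have h2 : run halfLine (β ++ ξ :: γ) ≤ shift 1 (run (run halfLine β) γ) := by
    rw [run_append, run_cons, ← run_shift]
    exact run_mono (h.step_le_shift ξ) γ
  have h3 : run halfLine (β ++ ξ :: γ) ≤ shift 1 (run halfLine (β ++ η :: γ)) :=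
    h2.trans fun j => h1 _
  have := (isProfile_run (β ++ ξ :: γ)).1.le_of_le ((isProfile_run (β ++ η :: γ)).1.shift 1) h3
  omega

/-! ### Averages over random words -/

/-- The expectation of `g ξ` for a geometric letter `ξ` of parameter `p`. -/
noncomputable def avg (p : ℝ) (g : ℕ+ → ℝ) : ℝ :=
  ∑' ξ : ℕ+, p * (1 - p) ^ ((ξ : ℕ) - 1) * g ξ

theorem hasSum_letterWeight {p : ℝ} (h0 : 0 < p) (h1 : p ≤ 1) :
    HasSum (fun ξ : ℕ+ => p * (1 - p) ^ ((ξ : ℕ) - 1)) 1 := by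
  rw [← Equiv.pnatEquivNat.symm.hasSum_iff]
  have := (hasSum_geometric_of_lt_one (r := 1 - p) (by linarith) (by linarith)).mul_left p
  rw [sub_sub_cancel, mul_inv_cancel₀ h0.ne'] at this
  simpa [Function.comp_def] using this

theorem letterWeight_nonneg {p : ℝ} (h0 : 0 < p) (h1 : p ≤ 1) (ξ : ℕ+) :
    0 ≤ p * (1 - p) ^ ((ξ : ℕ) - 1) :=
  mul_nonneg h0.le (pow_nonneg (by linarith) _)

section avg

variable {p : ℝ} {g g' : ℕ+ → ℝ} {B B' : ℝ}

theorem summable_avg (hg : ∀ ξ, |g ξ| ≤ B) (h0 : 0 < p) (h1 : p ≤ 1) :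
    Summable fun ξ : ℕ+ => p * (1 - p) ^ ((ξ : ℕ) - 1) * g ξ := by
  refine Summable.of_norm_bounded ((hasSum_letterWeight h0 h1).summable.mul_right B) fun ξ => ?_
  rw [norm_mul, Real.norm_of_nonneg (letterWeight_nonneg h0 h1 ξ)]
  exact mul_le_mul_of_nonneg_left (hg ξ) (letterWeight_nonneg h0 h1 ξ)

theorem avg_const (c : ℝ) (h0 : 0 < p) (h1 : p ≤ 1) : avg p (fun _ => c) = c := by
  rw [avg, tsum_mul_right, (hasSum_letterWeight h0 h1).tsum_eq, one_mul]

theorem avg_mul_left (c : ℝ) : avg p (fun ξ => c * g ξ) = c * avg p g := by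
  rw [avg, avg, ← tsum_mul_left]
  exact tsum_congr fun ξ => by ring

theorem avg_add (hg : ∀ ξ, |g ξ| ≤ B) (hg' : ∀ ξ, |g' ξ| ≤ B') (h0 : 0 < p) (h1 : p ≤ 1) :
    avg p (fun ξ => g ξ + g' ξ) = avg p g + avg p g' := by
  rw [avg, avg, avg, ← (summable_avg hg h0 h1).tsum_add (summable_avg hg' h0 h1)]
  exact tsum_congr fun ξ => by ring

theorem avg_mono (hg : ∀ ξ, |g ξ| ≤ B) (hg' : ∀ ξ, |g' ξ| ≤ B') (hle : ∀ ξ, g ξ ≤ g' ξ)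
    (h0 : 0 < p) (h1 : p ≤ 1) : avg p g ≤ avg p g' :=
  (summable_avg hg h0 h1).tsum_le_tsum
    (fun ξ => mul_le_mul_of_nonneg_left (hle ξ) (letterWeight_nonneg h0 h1 ξ))
    (summable_avg hg' h0 h1)

theorem abs_avg_le (hg : ∀ ξ, |g ξ| ≤ B) (h0 : 0 < p) (h1 : p ≤ 1) : |avg p g| ≤ B := by
  have hB : ∀ c : ℝ, ∀ _ : ℕ+, |c| ≤ |c| := fun _ _ => le_rfl
  rw [abs_le]
  constructor
  · have := avg_mono (hB (-B)) hg (fun ξ => (abs_le.1 (hg ξ)).1) h0 h1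
    rwa [avg_const _ h0 h1] at this
  · have := avg_mono hg (hB B) (fun ξ => (abs_le.1 (hg ξ)).2) h0 h1
    rwa [avg_const _ h0 h1] at this

end avg

/-- The expectation of `f` over words of `n` independent geometric letters of parameter `p`. -/
noncomputable def wordAvg (p : ℝ) : ℕ → (List ℕ+ → ℝ) → ℝ
  | 0, f => f []
  | n + 1, f => avg p fun ξ => wordAvg p n fun α => f (ξ :: α)

/-- `f` is bounded by `B` on the words of length `n`. -/
def BddAt (n : ℕ) (f : List ℕ+ → ℝ) (B : ℝ) : Prop :=
  ∀ α : List ℕ+, α.length = n → |f α| ≤ B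

theorem BddAt.cons {n : ℕ} {f : List ℕ+ → ℝ} {B : ℝ} (hf : BddAt (n + 1) f B) (ξ : ℕ+) :
    BddAt n (fun α => f (ξ :: α)) B := fun α hα => hf _ (by simp [hα])

section wordAvg

variable {p : ℝ} {n : ℕ} {f g : List ℕ+ → ℝ} {B B' : ℝ}

theorem abs_wordAvg_le (hf : BddAt n f B) (h0 : 0 < p) (h1 : p ≤ 1) : |wordAvg p n f| ≤ B := by
  induction n generalizing f with
  | zero => exact hf [] rfl
  | succ n ih => exact abs_avg_le (fun ξ => ih (hf.cons ξ)) h0 h1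

theorem wordAvg_const (c : ℝ) (h0 : 0 < p) (h1 : p ≤ 1) : wordAvg p n (fun _ => c) = c := by
  induction n with
  | zero => rfl
  | succ n ih => simp only [wordAvg, ih, avg_const c h0 h1]

theorem wordAvg_mul_left (c : ℝ) : wordAvg p n (fun α => c * f α) = c * wordAvg p n f := by
  induction n generalizing f with
  | zero => rfl
  | succ n ih => simp only [wordAvg, ih, avg_mul_left]

theorem wordAvg_congr (h : ∀ α : List ℕ+, α.length = n → f α = g α) :
    wordAvg p n f = wordAvg p n g := by
  induction n generalizing f g with
  | zero => exact h [] rfl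
  | succ n ih =>
    simp only [wordAvg]
    congr 1
    funext ξ
    exact ih fun α hα => h _ (by simp [hα])

theorem wordAvg_add (hf : BddAt n f B) (hg : BddAt n g B') (h0 : 0 < p) (h1 : p ≤ 1) :
    wordAvg p n (fun α => f α + g α) = wordAvg p n f + wordAvg p n g := by
  induction n generalizing f g with
  | zero => rfl
  | succ n ih =>
    simp only [wordAvg]
    rw [← avg_add (fun ξ => abs_wordAvg_le (hf.cons ξ) h0 h1)
      (fun ξ => abs_wordAvg_le (hg.cons ξ) h0 h1) h0 h1]
    congr 1
    funext ξ
    exact ih (hf.cons ξ) (hg.cons ξ)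

theorem wordAvg_sub (hf : BddAt n f B) (hg : BddAt n g B') (h0 : 0 < p) (h1 : p ≤ 1) :
    wordAvg p n (fun α => f α - g α) = wordAvg p n f - wordAvg p n g := by
  have hg' : BddAt n (fun α => (-1) * g α) B' := fun α hα => by simpa using hg α hα
  have := wordAvg_add hf hg' h0 h1
  rw [wordAvg_mul_left] at this
  calc _ = wordAvg p n (fun α => f α + (-1) * g α) := wordAvg_congr fun _ _ => by ring
    _ = _ := by rw [this]; ring

theorem wordAvg_mono (hf : BddAt n f B) (hg : BddAt n g B')
    (hle : ∀ α : List ℕ+, α.length = n → f α ≤ g α) (h0 : 0 < p) (h1 : p ≤ 1) :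
    wordAvg p n f ≤ wordAvg p n g := by
  induction n generalizing f g with
  | zero => exact hle [] rfl
  | succ n ih =>
    exact avg_mono (fun ξ => abs_wordAvg_le (hf.cons ξ) h0 h1)
      (fun ξ => abs_wordAvg_le (hg.cons ξ) h0 h1)
      (fun ξ => ih (hf.cons ξ) (hg.cons ξ) fun α hα => hle _ (by simp [hα])) h0 h1

theorem wordAvg_append (m : ℕ) : wordAvg p (n + m) f
    = wordAvg p n fun α => wordAvg p m fun β => f (α ++ β) := by
  induction n generalizing f with
  | zero => simp [wordAvg]
  | succ n ih =>
    rw [Nat.succ_add]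
    simp only [wordAvg, ih, List.cons_append]

theorem wordAvg_succ' : wordAvg p (n + 1) f
    = wordAvg p n fun α => avg p fun ξ => f (α ++ [ξ]) := by
  rw [wordAvg_append]
  rfl

theorem wordAvg_succ_tail (h0 : 0 < p) (h1 : p ≤ 1) :
    wordAvg p (n + 1) (fun α => f α.tail) = wordAvg p n f := by
  simp only [wordAvg, List.tail_cons, avg_const _ h0 h1]

/-- The bias-variance decomposition. -/
theorem wordAvg_sq_sub (hf : BddAt n f B) (c : ℝ) (h0 : 0 < p) (h1 : p ≤ 1) :
    wordAvg p n (fun α => (f α - c) ^ 2)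
      = wordAvg p n (fun α => (f α - wordAvg p n f) ^ 2) + (wordAvg p n f - c) ^ 2 := by
  set d := wordAvg p n f with hd
  have hc : ∀ c : ℝ, BddAt n (fun _ => c) |c| := fun _ _ _ => le_rfl
  have b1 : BddAt n (fun α => (f α - d) ^ 2) ((B + |d|) ^ 2) := fun α hα => by
    rw [abs_pow]
    exact pow_le_pow_left₀ (abs_nonneg _) ((abs_sub _ _).trans (by gcongr; exact hf α hα)) 2
  have b2 : BddAt n (fun α => (f α - d)) (B + |d|) := fun α hα =>
    (abs_sub _ _).trans (by gcongr; exact hf α hα)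
  have b3 : BddAt n (fun α => (2 * (d - c)) * (f α - d)) (|2 * (d - c)| * (B + |d|)) :=
    fun α hα => by
      rw [abs_mul]
      exact mul_le_mul_of_nonneg_left (b2 α hα) (abs_nonneg _)
  have e : wordAvg p n (fun α => f α - d) = 0 := by
    rw [wordAvg_sub hf (hc d) h0 h1, wordAvg_const _ h0 h1, ← hd, sub_self]
  calc wordAvg p n (fun α => (f α - c) ^ 2)
      = wordAvg p n (fun α => (f α - d) ^ 2 + (2 * (d - c)) * (f α - d) + (d - c) ^ 2) :=
        wordAvg_congr fun _ _ => by ring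
    _ = _ := by
      rw [wordAvg_add (B := (B + |d|) ^ 2 + |2 * (d - c)| * (B + |d|)) _ (hc _) h0 h1,
        wordAvg_add b1 b3 h0 h1, wordAvg_const _ h0 h1, wordAvg_mul_left, e]
      · ring
      · intro α hα
        exact (abs_add_le _ _).trans (add_le_add (b1 α hα) (b3 α hα))

/-- The Efron–Stein bound: if changing one letter changes `f` by at most one, the variance of `f`
over words of length `n` is at most `n`. The induction conditions on the first letter. -/
theorem wordAvg_variance_le (hf : BddAt n f B)
    (h : ∀ (β γ : List ℕ+) (ξ η : ℕ+), (β ++ ξ :: γ).length = n →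
      |f (β ++ ξ :: γ) - f (β ++ η :: γ)| ≤ 1) (h0 : 0 < p) (h1 : p ≤ 1) :
    wordAvg p n (fun α => (f α - wordAvg p n f) ^ 2) ≤ n := by
  induction n generalizing f with
  | zero => simp [wordAvg]
  | succ n ih =>
    set c := wordAvg p (n + 1) f with hc
    set F : ℕ+ → ℝ := fun ξ => wordAvg p n fun α => f (ξ :: α) with hF
    have hFB : ∀ ξ, |F ξ| ≤ B := fun ξ => abs_wordAvg_le (hf.cons ξ) h0 h1
    have hFd : ∀ ξ η, |F ξ - F η| ≤ 1 := fun ξ η => by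
      rw [hF]
      simp only
      rw [← wordAvg_sub (hf.cons ξ) (hf.cons η) h0 h1]
      exact abs_wordAvg_le (fun α hα => h [] α ξ η (by simp [hα])) h0 h1
    have hFc : ∀ ξ, |F ξ - c| ≤ 1 := fun ξ => by
      have e : c = avg p F := rfl
      have e2 : F ξ - c = avg p fun η => F ξ + (-1) * F η := by
        rw [avg_add (B := |F ξ|) (B' := B) (fun _ => le_rfl) (fun η => by simpa using hFB η) h0 h1,
          avg_mul_left, avg_const _ h0 h1, ← e]
        ring
      rw [e2]
      refine abs_avg_le (fun η => ?_) h0 h1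
      have := hFd ξ η
      rwa [sub_eq_add_neg, neg_eq_neg_one_mul] at this
    have b : BddAt (n + 1) (fun α => (f α - c) ^ 2) ((B + |c|) ^ 2) := fun α hα => by
      rw [abs_pow]
      exact pow_le_pow_left₀ (abs_nonneg _) ((abs_sub _ _).trans (by gcongr; exact hf α hα)) 2
    calc wordAvg p (n + 1) (fun α => (f α - c) ^ 2)
        = avg p fun ξ => wordAvg p n fun α => (f (ξ :: α) - c) ^ 2 := rfl
      _ ≤ avg p fun _ => ((n : ℝ) + 1) := by
        refine avg_mono (fun ξ => abs_wordAvg_le (b.cons ξ) h0 h1) (fun _ => le_rfl)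
          (fun ξ => ?_) h0 h1
        rw [wordAvg_sq_sub (hf.cons ξ) c h0 h1]
        refine add_le_add (ih (hf.cons ξ) fun β γ ξ' η hl => ?_) ?_
        · exact h (ξ :: β) γ ξ' η (by simpa using hl)
        · exact (sq_le_one_iff_abs_le_one _).2 (hFc ξ)
      _ = _ := by rw [avg_const _ h0 h1]; push_cast; rfl

end wordAvg

theorem bddAt_frontCount (n : ℕ) : BddAt n (fun α => (frontCount α : ℝ)) n := fun α hα => by
  have := (isProfile_run α).2
  simp only [Nat.abs_cast]
  exact_mod_cast hα ▸ this

theorem wordAvg_frontCount_variance_le {p : ℝ} (h0 : 0 < p) (h1 : p ≤ 1) (n : ℕ) :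
    wordAvg p n (fun α => ((frontCount α : ℝ) - wordAvg p n fun α => (frontCount α : ℝ)) ^ 2)
      ≤ n := by
  refine wordAvg_variance_le (bddAt_frontCount n) (fun β γ ξ η _ => ?_) h0 h1
  have e1 := frontCount_replace β γ ξ η
  have e2 := frontCount_replace β γ η ξ
  rw [abs_le]
  constructor <;> rw [← sub_nonneg]
  · have : (frontCount (β ++ η :: γ) : ℝ) ≤ frontCount (β ++ ξ :: γ) + 1 := by exact_mod_cast e2
    linarith
  · have : (frontCount (β ++ ξ :: γ) : ℝ) ≤ frontCount (β ++ η :: γ) + 1 := by exact_mod_cast e1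
    linarith

/-- The expected displacement of the front after `n` random letters. -/
noncomputable def meanFront (p : ℝ) (n : ℕ) : ℝ := wordAvg p n fun α => (frontCount α : ℝ)

theorem subadditive_meanFront {p : ℝ} (h0 : 0 < p) (h1 : p ≤ 1) :
    Subadditive (meanFront p) := by
  intro n m
  unfold meanFront
  rw [wordAvg_append]
  have e : ∀ α : List ℕ+, BddAt m (fun β => (frontCount (α ++ β) : ℝ)) (α.length + m : ℕ) :=
    fun α β hβ => by
      have := (isProfile_run (α ++ β)).2
      rw [List.length_append, hβ] at this
      simp only [Nat.abs_cast]
      exact_mod_cast this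
  have b : BddAt n (fun α => wordAvg p m fun β => (frontCount (α ++ β) : ℝ)) (n + m : ℕ) :=
    fun α hα => hα ▸ abs_wordAvg_le (e α) h0 h1
  have hc : ∀ c : ℝ, ∀ k, BddAt k (fun _ => c) |c| := fun _ _ _ _ => le_rfl
  set c := wordAvg p m fun α => (frontCount α : ℝ) with hcdef
  calc wordAvg p n (fun α => wordAvg p m fun β => (frontCount (α ++ β) : ℝ))
      ≤ wordAvg p n fun α => (frontCount α : ℝ) + c := by
        refine wordAvg_mono (B' := n + |c|) b (fun α hα => ?_) (fun α hα => ?_) h0 h1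
        · exact (abs_add_le _ _).trans (add_le_add (bddAt_frontCount n α hα) le_rfl)
        · have b1 : BddAt m (fun β => (frontCount α : ℝ) + (frontCount β : ℝ))
              (|(frontCount α : ℝ)| + m) := fun β hβ =>
            (abs_add_le _ _).trans (add_le_add le_rfl (bddAt_frontCount m β hβ))
          refine (wordAvg_mono (e α) b1 (fun β _ => ?_) h0 h1).trans_eq ?_
          · exact_mod_cast frontCount_append_le α β
          · rw [wordAvg_add (hc _ m) (bddAt_frontCount m) h0 h1, wordAvg_const _ h0 h1]
    _ = _ := by
      rw [wordAvg_add (bddAt_frontCount n) (hc c n) h0 h1, wordAvg_const _ h0 h1]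

theorem meanFront_nonneg {p : ℝ} (h0 : 0 < p) (h1 : p ≤ 1) (n : ℕ) : 0 ≤ meanFront p n := by
  have := wordAvg_mono (p := p) (f := fun _ => (0 : ℝ)) (B := 0) (fun _ _ => by simp)
    (bddAt_frontCount n) (fun α _ => by positivity) h0 h1
  rwa [wordAvg_const _ h0 h1] at this

theorem exists_tendsto_meanFront {p : ℝ} (h0 : 0 < p) (h1 : p ≤ 1) :
    ∃ c, Tendsto (fun n : ℕ => meanFront p n / n) atTop (𝓝 c) :=
  ⟨_, (subadditive_meanFront h0 h1).tendsto_lim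
    ⟨0, by rintro _ ⟨n, rfl⟩; exact div_nonneg (meanFront_nonneg h0 h1 n) n.cast_nonneg⟩⟩

open scoped Classical in
/-- The indicator of `FrontWord N`. -/
noncomputable def frontInd (N : ℤ → ℕ∞) (α : List ℕ+) : ℝ := if FrontWord N α then 1 else 0

theorem bddAt_frontInd (N : ℤ → ℕ∞) (n : ℕ) : BddAt n (frontInd N) 1 := fun α _ => by
  unfold frontInd
  split_ifs <;> simp

/-- The front moves at the last letter exactly when the word is in `FrontWord`. -/
theorem meanFront_succ {p : ℝ} (h0 : 0 < p) (h1 : p ≤ 1) (n : ℕ) :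
    meanFront p (n + 1) = meanFront p n + wordAvg p (n + 1) (frontInd halfLine) := by
  unfold meanFront
  rw [wordAvg_succ', wordAvg_succ', ← wordAvg_add (bddAt_frontCount n) (B' := 1) _ h0 h1]
  · refine wordAvg_congr fun α _ => ?_
    have b := fun ξ => bddAt_frontInd halfLine _ (α ++ [ξ]) rfl
    rw [← avg_const (p := p) (frontCount α : ℝ) h0 h1, ← avg_add (fun _ => le_rfl) b h0 h1]
    congr 1
    funext ξ
    rw [frontCount_append_singleton, frontInd]
    split_ifs <;> simp
  · exact fun α _ => abs_avg_le (fun ξ => bddAt_frontInd halfLine _ _ rfl) h0 h1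

/-! ### Sums over all words -/

theorem height_cons (a : ℕ+) (α : List ℕ+) : height (a :: α) = ((a : ℕ) - 1) + height α := by
  have e1 := length_add_height α
  have e2 := length_add_height (a :: α)
  simp only [List.length_cons, List.map_cons, List.sum_cons] at e2
  have := a.pos
  omega

/-- A word of length `n + 1` is a letter followed by a word of length `n`. -/
def consEquiv (n : ℕ) : ℕ+ × {α : List ℕ+ // α.length = n} ≃ {α : List ℕ+ // α.length = n + 1} where
  toFun x := ⟨x.1 :: x.2.1, by simp [x.2.2]⟩
  invFun α := ⟨α.1.head (by have := α.2; intro h; simp [h] at this), α.1.tail, by simp [α.2]⟩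
  left_inv x := by simp
  right_inv α := by simp

theorem hasSum_wordAvg {p : ℝ} {n : ℕ} {f : List ℕ+ → ℝ} {B : ℝ} (hf : BddAt n f B)
    (h0 : 0 < p) (h1 : p ≤ 1) :
    HasSum (fun α : {α : List ℕ+ // α.length = n} => p ^ n * (1 - p) ^ height α.1 * f α)
      (wordAvg p n f) := by
  induction n generalizing f B with
  | zero =>
    have : Unique {α : List ℕ+ // α.length = 0} :=
      ⟨⟨⟨[], rfl⟩⟩, fun α => Subtype.ext (List.length_eq_zero_iff.1 α.2)⟩
    have h := hasSum_unique fun α : {α : List ℕ+ // α.length = 0} =>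
      p ^ 0 * (1 - p) ^ height α.1 * f α
    convert h using 1
    simp only [wordAvg, pow_zero, one_mul]
    have : (default : {α : List ℕ+ // α.length = 0}).1 = [] :=
      List.length_eq_zero_iff.1 (default : {α : List ℕ+ // α.length = 0}).2
    simp [this, height]
  | succ n ih =>
    have q0 : 0 ≤ 1 - p := by linarith
    rw [← (consEquiv n).hasSum_iff]
    have e : ∀ x : ℕ+ × {α : List ℕ+ // α.length = n},
        ((fun α : {α : List ℕ+ // α.length = n + 1} =>
          p ^ (n + 1) * (1 - p) ^ height α.1 * f α) ∘ consEquiv n) x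
        = (p * (1 - p) ^ ((x.1 : ℕ) - 1)) * (p ^ n * (1 - p) ^ height x.2.1 * f (x.1 :: x.2.1)) := by
      intro x
      simp only [Function.comp, consEquiv, Equiv.coe_fn_mk, height_cons]
      ring
    have b1 : BddAt n (fun _ => (1 : ℝ)) 1 := fun _ _ => by simp
    have s1 := (ih b1).summable
    simp only [mul_one] at s1
    have s2 := (hasSum_letterWeight h0 h1).summable.mul_of_nonneg s1
      (letterWeight_nonneg h0 h1) (fun α => by positivity)
    have hs : Summable ((fun α : {α : List ℕ+ // α.length = n + 1} =>
          p ^ (n + 1) * (1 - p) ^ height α.1 * f α) ∘ consEquiv n) := by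
      refine Summable.of_norm_bounded (s2.mul_right B) fun x => ?_
      rw [e x, ← mul_assoc, norm_mul]
      have n0 : 0 ≤ p * (1 - p) ^ ((x.1 : ℕ) - 1) * (p ^ n * (1 - p) ^ height x.2.1) := by
        positivity
      rw [Real.norm_of_nonneg n0]
      exact mul_le_mul_of_nonneg_left (hf _ (by simp [x.2.2])) n0
    have h2 := hs.hasSum.prod_fiberwise (g := fun ξ : ℕ+ => (p * (1 - p) ^ ((ξ : ℕ) - 1)) *
      wordAvg p n fun α => f (ξ :: α)) fun ξ => by
        simp only [e]
        exact (ih (hf.cons ξ)).mul_left _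
    have h3 : wordAvg p (n + 1) f = _ := h2.tsum_eq
    rw [h3]
    exact hs.hasSum

theorem summable_words {a b : ℝ} (ha : 0 ≤ a) (hb : 0 ≤ b) (hab : a + b < 1) :
    Summable fun α : List ℕ+ => a ^ α.length * b ^ height α := by
  have hb1 : 0 < 1 - b := by linarith
  rw [← (Equiv.sigmaFiberEquiv (List.length : List ℕ+ → ℕ)).summable_iff]
  have hfib : ∀ n : ℕ, HasSum (fun α : {α : List ℕ+ // α.length = n} =>
      a ^ α.1.length * b ^ height α.1) ((a / (1 - b)) ^ n) := fun n => by
    have h := hasSum_wordAvg (p := 1 - b) (n := n) (f := fun _ => 1) (B := 1)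
      (fun _ _ => by simp) hb1 (by linarith)
    rw [wordAvg_const _ hb1 (by linarith)] at h
    have h' := h.mul_left ((a / (1 - b)) ^ n)
    rw [mul_one] at h'
    refine h'.congr_fun fun α => ?_
    rw [α.2, sub_sub_cancel, div_pow]
    field_simp
  refine (summable_sigma_of_nonneg fun x => mul_nonneg (pow_nonneg ha _) (pow_nonneg hb _)).2
    ⟨fun n => (hfib n).summable, ?_⟩
  have : (fun n : ℕ => ∑' α : {α : List ℕ+ // α.length = n},
      a ^ α.1.length * b ^ height α.1) = fun n => (a / (1 - b)) ^ n :=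
    funext fun n => (hfib n).tsum_eq
  exact this ▸ summable_geometric_of_lt_one (by positivity)
    ((div_lt_one hb1).2 (by linarith))

/-- An exponential Chebyshev bound: on the words of length at most `height + 1` the factor
`θ ^ (height + 1 - length)` is at least one, and inserting it turns the sum into one over all words
with the weights `a / θ` and `θ * b`. -/
theorem summable_short_words {a b θ : ℝ} (ha : 0 ≤ a) (hb : 0 ≤ b) (hθ : 1 ≤ θ)
    (h : a < θ * (1 - θ * b)) :
    Summable fun α : List ℕ+ => if α.length ≤ height α + 1 then a ^ α.length * b ^ height α
      else 0 := by
  have hθ0 : 0 < θ := by linarith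
  have hs := (summable_words (a := a / θ) (b := θ * b) (by positivity) (by positivity) (by
    rw [← sub_pos] at h ⊢
    have : 1 - (a / θ + θ * b) = (θ * (1 - θ * b) - a) / θ := by field_simp; ring
    rw [this]
    positivity)).mul_left θ
  refine Summable.of_nonneg_of_le (fun α => ?_) (fun α => ?_) hs
  · split_ifs <;> positivity
  · split_ifs with hl
    · have h1 : θ ^ α.length ≤ θ ^ (height α + 1) := pow_le_pow_right₀ hθ hl
      rw [div_pow, mul_pow]
      have : θ * (a ^ α.length / θ ^ α.length * (θ ^ height α * b ^ height α))
          = (θ ^ (height α + 1) / θ ^ α.length) * (a ^ α.length * b ^ height α) := by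
        rw [pow_succ]; field_simp
      rw [this]
      refine le_mul_of_one_le_left (by positivity) ?_
      rwa [one_le_div (by positivity)]
    · positivity

/-! ### The signed sum over words as the speed of the front -/

theorem summable_sign_mul {X : Config} (hX : Admissible X) {a b θ : ℝ} (ha : 0 ≤ a) (hb : 0 ≤ b)
    (hθ : 1 ≤ θ) (h : a < θ * (1 - θ * b)) :
    Summable fun α : List ℕ+ => |(sign X α : ℝ)| * (a ^ α.length * b ^ height α) := by
  refine Summable.of_nonneg_of_le (fun α => by positivity) (fun α => ?_)
    (summable_short_words ha hb hθ h)
  split_ifs with hl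
  · refine mul_le_of_le_one_left (by positivity) ?_
    exact_mod_cast abs_sign_le_one X α
  · rw [sign_eq_zero hX (by omega)]
    simp

/-- The hypothesis of `summable_short_words` for `a = p`, `b = 1 - p` and `θ = 2 * p`. The difference
of the two sides is `p * (2 * p - 1) ^ 2`. -/
theorem lt_two_mul {p : ℝ} (hp : 1 / 2 < p) : p < 2 * p * (1 - 2 * p * (1 - p)) := by
  nlinarith [mul_pos (show 0 < p by linarith) (pow_pos (show 0 < 2 * p - 1 by linarith) 2)]

/-- The sum of `sign X α` over all words, weighted by their probabilities under geometric letters. -/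
noncomputable def signSum (X : Config) (p : ℝ) : ℝ :=
  ∑' α : List ℕ+, (sign X α : ℝ) * (p ^ α.length * (1 - p) ^ height α)

theorem hasSum_signSum {X : Config} (hX : Admissible X) {p θ : ℝ} (h0 : 0 ≤ p) (h1 : p ≤ 1)
    (hθ : 1 ≤ θ) (h : p < θ * (1 - θ * (1 - p))) :
    HasSum (fun α : List ℕ+ => (sign X α : ℝ) * (p ^ α.length * (1 - p) ^ height α))
      (signSum X p) := by
  refine Summable.hasSum (Summable.of_norm ?_)
  refine (summable_sign_mul hX h0 (by linarith : 0 ≤ 1 - p) hθ h).congr fun α => ?_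
  have : 0 ≤ 1 - p := by linarith
  rw [norm_mul, Real.norm_eq_abs, Real.norm_of_nonneg (by positivity)]

theorem hasSum_length {p : ℝ} (h0 : 0 < p) (h1 : p ≤ 1) {f : List ℕ+ → ℝ} {B s : ℝ}
    (hf : ∀ n, BddAt n f B)
    (hs : HasSum (fun α => f α * (p ^ α.length * (1 - p) ^ height α)) s) :
    HasSum (fun n => wordAvg p n f) s := by
  rw [← (Equiv.sigmaFiberEquiv (List.length : List ℕ+ → ℕ)).hasSum_iff] at hs
  refine hs.sigma fun n => (hasSum_wordAvg (hf n) h0 h1).congr_fun fun α => ?_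
  obtain ⟨α, rfl⟩ := α
  simp only [Function.comp, Equiv.sigmaFiberEquiv, Equiv.coe_fn_mk]
  ring

theorem sign_eq_frontInd {X : Config} (hX : Admissible X) (α : List ℕ+) :
    (sign X α : ℝ) = frontInd (ballsFrom X) α - frontInd (ballsFrom X) α.tail := by
  classical
  simp only [sign, frontInd, hX.mem_frontWords]
  push_cast
  rfl

/-- The sum of the signs over words of length `n` telescopes: removing the first letter of a random
word leaves a random word of length `n - 1`. -/
theorem tendsto_wordAvg_frontInd {X : Config} (hX : Admissible X) {p : ℝ} (hp : 1 / 2 < p)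
    (h1 : p ≤ 1) :
    Tendsto (fun n => wordAvg p n (frontInd (ballsFrom X))) atTop (𝓝 (signSum X p)) := by
  have h0 : 0 < p := by linarith
  have hs := hasSum_length (B := 1) h0 h1 (fun n α _ => by exact_mod_cast abs_sign_le_one X α)
    (hasSum_signSum hX h0.le h1 (by linarith : 1 ≤ 2 * p) (lt_two_mul hp))
  have ht := hs.tendsto_sum_nat.comp (tendsto_add_atTop_nat 1)
  refine ht.congr fun n => ?_
  simp only [Function.comp]
  induction n with
  | zero =>
    have hnil : ([] : List ℕ+) ∉ frontWords X := by
      rw [hX.mem_frontWords]; exact not_frontWord_nil _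
    simp [wordAvg, sign, frontInd, not_frontWord_nil, hnil]
  | succ n ih =>
    rw [Finset.sum_range_succ, ih, wordAvg_congr fun α _ => sign_eq_frontInd hX α,
      wordAvg_sub (B := 1) (B' := 1) (bddAt_frontInd _ _) (fun α _ => ?_) h0 h1,
      wordAvg_succ_tail h0 h1]
    · ring
    · exact bddAt_frontInd _ _ α.tail rfl

theorem signSum_eq {X Y : Config} (hX : Admissible X) (hY : Admissible Y) {p : ℝ}
    (hp : 1 / 2 < p) (h1 : p ≤ 1) : signSum X p = signSum Y p := by
  have h0 : 0 < p := by linarith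
  set S : List ℕ+ → ℝ := fun α => if α.length ≤ height α + 1 then 1 else 0 with hS
  have hSB : ∀ n, BddAt n S 1 := fun n α _ => by
    rw [hS]; simp only; split_ifs <;> simp
  have hs := (summable_short_words h0.le (by linarith : 0 ≤ 1 - p) (by linarith : 1 ≤ 2 * p)
    (lt_two_mul hp)).hasSum
  have hs' := hasSum_length h0 h1 hSB (hs.congr_fun fun α => by
    rw [hS]; simp only; split_ifs <;> simp)
  have ht := hs'.summable.tendsto_atTop_zero
  have hd := (tendsto_wordAvg_frontInd hX hp h1).sub (tendsto_wordAvg_frontInd hY hp h1)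
  have hz : Tendsto (fun n => wordAvg p n (frontInd (ballsFrom X)) -
      wordAvg p n (frontInd (ballsFrom Y))) atTop (𝓝 0) := by
    refine squeeze_zero_norm (fun n => ?_) ht
    obtain ⟨m, hm⟩ := hX
    obtain ⟨m', hm'⟩ := hY
    have hle : ∀ α : List ℕ+,
        |frontInd (ballsFrom X) α - frontInd (ballsFrom Y) α| ≤ S α := fun α => by
      by_cases hl : height α < α.length
      · have := frontWord_iff_of_height_lt (Admissible.isProfile hm) (Admissible.isProfile hm') hl
        have e : frontInd (ballsFrom X) α = frontInd (ballsFrom Y) α := by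
          classical
          exact if_congr this rfl rfl
        rw [e, sub_self, abs_zero, hS]
        simp only
        split_ifs <;> simp
      · rw [hS]
        simp only
        rw [if_pos (by omega)]
        unfold frontInd
        split_ifs <;> simp
    have b : BddAt n (fun α => frontInd (ballsFrom X) α - frontInd (ballsFrom Y) α) 1 :=
      fun α hα => (hle α).trans ((le_abs_self _).trans (hSB n α hα))
    have b' : BddAt n (fun α => (-1) * S α) 1 := fun α hα => by simpa using hSB n α hα
    rw [← wordAvg_sub (bddAt_frontInd _ _) (bddAt_frontInd _ _) h0 h1, Real.norm_eq_abs, abs_le]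
    constructor
    · have := wordAvg_mono b' b (fun α _ => by have := (abs_le.1 (hle α)).1; linarith) h0 h1
      rw [wordAvg_mul_left] at this
      linarith
    · exact wordAvg_mono b (hSB n) (fun α _ => (abs_le.1 (hle α)).2) h0 h1
  have := tendsto_nhds_unique hd hz
  linarith

theorem tendsto_meanFront {X : Config} (hX : Admissible X) {p : ℝ} (hp : 1 / 2 < p)
    (h1 : p ≤ 1) : Tendsto (fun n : ℕ => meanFront p n / n) atTop (𝓝 (signSum X p)) := by
  have h0 : 0 < p := by linarith
  have h := (tendsto_wordAvg_frontInd admissible_halfLine hp h1).comp (tendsto_add_atTop_nat 1)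
  rw [signSum_eq admissible_halfLine hX hp h1, ballsFrom_halfLine] at h
  refine h.cesaro.congr fun n => ?_
  rw [div_eq_inv_mul]
  congr 1
  induction n with
  | zero => simp [meanFront, wordAvg, frontCount_nil]
  | succ n ih => rw [Finset.sum_range_succ, ih, meanFront_succ h0 h1]; rfl

/-! ### Expansion in powers of `1 - p` -/

theorem hasSum_choose (L H : ℕ) (x : ℝ) :
    HasSum (fun k : ℕ => if H ≤ k then (L.choose (k - H) : ℝ) * x ^ (k - H) else 0)
      ((1 + x) ^ L) := by
  rw [← (add_left_injective H).hasSum_iff]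
  · have h : HasSum (fun i : ℕ => (L.choose i : ℝ) * x ^ i)
        (∑ i ∈ Finset.range (L + 1), (L.choose i : ℝ) * x ^ i) := by
      refine hasSum_sum_of_ne_finset_zero fun i hi => ?_
      rw [Nat.choose_eq_zero_of_lt (by simpa using hi), Nat.cast_zero, zero_mul]
    convert h using 1
    · funext i
      simp [Function.comp]
    · rw [add_comm 1 x, add_pow]
      exact Finset.sum_congr rfl fun i _ => by ring
  · intro k hk
    rw [if_neg]
    exact fun hle => hk ⟨k - H, by simp [hle]⟩

/-- Expand `p ^ L = (1 - (1 - p)) ^ L` and collect the powers of `1 - p`; the hypothesis gives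
absolute convergence of the resulting double series, since `∑ i, L.choose i * q ^ i = (1 + q) ^ L`. -/
theorem hasSum_coeff {X : Config} (hX : Admissible X) {p θ : ℝ} (h1 : p ≤ 1)
    (hθ : 1 ≤ θ) (h : 1 + (1 - p) < θ * (1 - θ * (1 - p))) :
    HasSum (fun k : ℕ => (coeff X k : ℝ) * (1 - p) ^ k) (signSum X p) := by
  set q := 1 - p with hq
  have q0 : 0 ≤ q := by linarith
  set G : List ℕ+ × ℕ → ℝ := fun x => (sign X x.1 : ℝ) * q ^ height x.1 *
    (if height x.1 ≤ x.2 then (x.1.length.choose (x.2 - height x.1) : ℝ) *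
      (-q) ^ (x.2 - height x.1) else 0) with hG
  have habs : ∀ x, ‖G x‖ = |(sign X x.1 : ℝ)| * q ^ height x.1 *
      (if height x.1 ≤ x.2 then (x.1.length.choose (x.2 - height x.1) : ℝ) *
        q ^ (x.2 - height x.1) else 0) := fun x => by
    rw [hG]
    simp only [norm_mul, Real.norm_eq_abs, abs_of_nonneg (pow_nonneg q0 _)]
    congr 1
    split_ifs
    · rw [abs_mul, abs_pow, abs_neg, abs_of_nonneg q0, Nat.abs_cast]
    · simp
  have hs : Summable G := by
    refine Summable.of_norm ?_
    rw [summable_prod_of_nonneg fun x => norm_nonneg _]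
    have hfib : ∀ α : List ℕ+, HasSum (fun k => ‖G (α, k)‖)
        (|(sign X α : ℝ)| * q ^ height α * (1 + q) ^ α.length) := fun α => by
      simp only [habs]
      exact (hasSum_choose α.length (height α) q).mul_left _
    refine ⟨fun α => (hfib α).summable, ?_⟩
    refine (summable_sign_mul hX (by linarith : 0 ≤ 1 + q) q0 hθ h).congr fun α => ?_
    rw [(hfib α).tsum_eq]
    ring
  have e1 : HasSum (fun α : List ℕ+ => (sign X α : ℝ) * (p ^ α.length * q ^ height α))
      (∑' x, G x) :=
    hs.hasSum.prod_fiberwise fun α => by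
      have := (hasSum_choose α.length (height α) (-q)).mul_left ((sign X α : ℝ) * q ^ height α)
      rw [show 1 + -q = p by rw [hq]; ring] at this
      rwa [mul_comm (p ^ α.length), ← mul_assoc]
  have e2 : signSum X p = ∑' x, G x := e1.tsum_eq
  rw [e2]
  refine ((Equiv.prodComm _ _).hasSum_iff.2 hs.hasSum).prod_fiberwise fun k => ?_
  have e3 : (coeff X k : ℝ) * q ^ k = ∑ α ∈ (finite_words k).toFinset, G (α, k) := by
    rw [coeff]
    push_cast
    rw [Finset.sum_mul]
    refine Finset.sum_congr rfl fun α hα => ?_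
    have hα' : height α ≤ k := ((finite_words k).mem_toFinset.1 hα).1
    rw [hG]
    simp only [if_pos hα']
    rw [neg_pow q]
    conv_lhs => rw [← Nat.add_sub_cancel' hα', pow_add, Nat.add_sub_cancel' hα']
    ring
  rw [e3]
  refine hasSum_sum_of_ne_finset_zero fun α hα => ?_
  rw [Set.Finite.mem_toFinset] at hα
  change G (α, k) = 0
  rw [hG]
  simp only
  by_cases hk : height α ≤ k
  · rw [sign_eq_zero hX]
    · simp
    · by_contra hlt
      exact hα ⟨hk, by omega⟩
  · rw [if_neg hk, mul_zero]

/-! ### Analyticity of the signed sum -/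

/-- The series converges normally on a complex disc around each `p₀ > 1 / 2`, including `p₀ = 1`. -/
theorem analyticOn_signSum {X : Config} (hX : Admissible X) :
    AnalyticOn ℝ (signSum X) (Set.Ioc (1 / 2) 1) := by
  intro p₀ hp₀
  set F : ℂ → ℂ := fun z => ∑' α : List ℕ+,
    ((sign X α : ℝ) : ℂ) * (z ^ α.length * (1 - z) ^ height α) with hF
  -- The slack in `lt_two_mul` at `p₀` is `p₀ * (2 * p₀ - 1) ^ 2`; moving both parameters by `s`
  -- consumes at most `5 * s` of it.
  set s : ℝ := p₀ * (2 * p₀ - 1) ^ 2 / 10 with hs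
  have hs0 : 0 < s := by
    have h1 : 0 < p₀ := by linarith [hp₀.1]
    have h2 : 0 < 2 * p₀ - 1 := by linarith [hp₀.1]
    positivity
  have hcond : p₀ + s < 2 * p₀ * (1 - 2 * p₀ * (1 - p₀ + s)) := by
    have h2 : 4 * p₀ ^ 2 * s ≤ 4 * s := by
      nlinarith [hp₀.1, hp₀.2, mul_nonneg hs0.le (show 0 ≤ 1 - p₀ ^ 2 by nlinarith [hp₀.1, hp₀.2])]
    have h3 : 10 * s = p₀ * (2 * p₀ - 1) ^ 2 := by rw [hs]; ring
    nlinarith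
  have hball : ∀ z ∈ Metric.ball (p₀ : ℂ) s, ‖z‖ ≤ p₀ + s ∧ ‖1 - z‖ ≤ 1 - p₀ + s := by
    intro z hz
    rw [mem_ball_iff_norm] at hz
    have hp0 : 0 ≤ p₀ := by linarith [hp₀.1]
    constructor
    · calc ‖z‖ = ‖(p₀ : ℂ) + (z - p₀)‖ := by ring_nf
        _ ≤ ‖(p₀ : ℂ)‖ + ‖z - p₀‖ := norm_add_le _ _
        _ ≤ p₀ + s := by
          rw [Complex.norm_real, Real.norm_of_nonneg hp0]
          linarith
    · calc ‖1 - z‖ = ‖((1 - p₀ : ℝ) : ℂ) - (z - p₀)‖ := by push_cast; ring_nf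
        _ ≤ ‖((1 - p₀ : ℝ) : ℂ)‖ + ‖z - p₀‖ := norm_sub_le _ _
        _ ≤ 1 - p₀ + s := by
          rw [Complex.norm_real, Real.norm_of_nonneg (by linarith [hp₀.2])]
          linarith
  have hdiff : DifferentiableOn ℂ F (Metric.ball (p₀ : ℂ) s) := by
    refine Complex.differentiableOn_tsum_of_summable_norm
      (summable_sign_mul hX (a := p₀ + s) (b := 1 - p₀ + s) (θ := 2 * p₀)
        (by linarith [hp₀.1]) (by linarith [hp₀.2]) (by linarith [hp₀.1]) hcond)
      (fun α => ?_) Metric.isOpen_ball fun α z hz => ?_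
    · fun_prop
    · rw [norm_mul, norm_mul, norm_pow, norm_pow, Complex.norm_real, Real.norm_eq_abs]
      obtain ⟨h1, h2⟩ := hball z hz
      have h3 : 0 ≤ p₀ + s := (norm_nonneg z).trans h1
      gcongr
  have hF' : AnalyticAt ℂ F p₀ :=
    hdiff.analyticAt (Metric.isOpen_ball.mem_nhds (Metric.mem_ball_self hs0))
  have e : signSum X = fun p : ℝ => (F p).re := by
    funext p
    have : F p = (signSum X p : ℂ) := by
      rw [hF, signSum, Complex.ofReal_tsum]
      push_cast
      rfl
    rw [this, Complex.ofReal_re]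
  rw [e]
  exact hF'.re_ofReal.analyticWithinAt

end InfiniteBin

namespace BarakErdos

open InfiniteBin

/-! ### Longest paths through the vertices they end at -/

/-- `G.Reach k v`: some directed path of length `k` ends at `v`. -/
def Graph.Reach (G : Graph) : ℕ → ℕ → Prop
  | 0, _ => True
  | k + 1, v => ∃ u, G.Edge u v ∧ G.Reach k u

theorem Graph.Edge.lt {G : Graph} {u v : ℕ} (h : G.Edge u v) : u < v := h.1

theorem Graph.Reach.of_succ {G : Graph} {k v : ℕ} (h : G.Reach (k + 1) v) : G.Reach k v := by
  induction k generalizing v with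
  | zero => trivial
  | succ k ih =>
    obtain ⟨u, hu, hr⟩ := h
    exact ⟨u, hu, ih hr⟩

theorem Graph.Reach.mono {G : Graph} {k l v : ℕ} (hkl : k ≤ l) (h : G.Reach l v) :
    G.Reach k v := by
  induction hkl with
  | refl => exact h
  | step _ ih => exact ih h.of_succ

theorem Graph.Reach.le {G : Graph} {k v : ℕ} (h : G.Reach k v) : k ≤ v := by
  induction k generalizing v with
  | zero => exact Nat.zero_le v
  | succ k ih =>
    obtain ⟨u, hu, hr⟩ := h
    have := ih hr
    have := hu.lt
    omega

theorem Graph.hasPath_iff (G : Graph) (n k : ℕ) : G.HasPath n k ↔ ∃ v < n, G.Reach k v := by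
  constructor
  · rintro ⟨w, hw⟩
    have h : ∀ i : Fin (k + 1), G.Reach i (w i) := by
      intro i
      induction i using Fin.induction with
      | zero => trivial
      | succ i ih => exact ⟨w i.castSucc, hw i, ih⟩
    exact ⟨w (Fin.last k), (w (Fin.last k)).2, h (Fin.last k)⟩
  · rintro ⟨v, hv, hr⟩
    suffices ∃ w : Fin (k + 1) → Fin n, w (Fin.last k) = ⟨v, hv⟩ ∧
        ∀ i : Fin k, G.Edge (w i.castSucc) (w i.succ) from
      this.imp fun w h => h.2
    induction k generalizing v with
    | zero => exact ⟨fun _ => ⟨v, hv⟩, rfl, fun i => i.elim0⟩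
    | succ k ih =>
      obtain ⟨u, hu, hr⟩ := hr
      obtain ⟨w, hw, he⟩ := ih u (hu.lt.trans hv) hr
      refine ⟨Fin.snoc w ⟨v, hv⟩, Fin.snoc_last _ _, fun i => ?_⟩
      rw [Fin.snoc_castSucc]
      induction i using Fin.lastCases with
      | last => rw [Fin.succ_last, Fin.snoc_last, hw]; exact hu
      | cast i => rw [Fin.succ_castSucc, Fin.snoc_castSucc]; exact he i

theorem Graph.hasPath_iff_le_longestPath (G : Graph) {n : ℕ} (hn : 0 < n) (k : ℕ) :
    G.HasPath n k ↔ k ≤ G.longestPath n := by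
  constructor
  · exact fun h => le_csSup (G.bddAbove_hasPath n) h
  · intro hk
    have hne : {k | G.HasPath n k}.Nonempty := ⟨0, (G.hasPath_iff n 0).2 ⟨0, hn, trivial⟩⟩
    have h := Nat.sSup_mem hne (G.bddAbove_hasPath n)
    obtain ⟨v, hv, hr⟩ := (G.hasPath_iff _ _).1 h
    exact (G.hasPath_iff _ _).2 ⟨v, hv, hr.mono hk⟩

theorem Graph.monotone_longestPath (G : Graph) : Monotone G.longestPath := by
  intro n m hnm
  rcases Nat.eq_zero_or_pos n with rfl | hn
  · have : {k | G.HasPath 0 k} = ∅ := by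
      ext k
      simp [G.hasPath_iff]
    simp [Graph.longestPath, this]
  · rw [← G.hasPath_iff_le_longestPath (hn.trans_le hnm), G.hasPath_iff]
    obtain ⟨v, hv, hr⟩ := (G.hasPath_iff _ _).1 ((G.hasPath_iff_le_longestPath hn _).2 le_rfl)
    exact ⟨v, hv.trans_le hnm, hr⟩

/-! ### The profile of a graph -/

open scoped Classical in
/-- The first `n` vertices as balls: a vertex sits in the bin whose index is the length of the longest
path ending at it, so that the entry at `j ≥ 0` counts the vertices at which a path of length `j`
ends. The bins of negative index are full, as in `halfLine`. -/
noncomputable def Graph.profile (G : Graph) (n : ℕ) : ℤ → ℕ∞ := fun j =>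
  if j < 0 then ⊤ else (((Finset.range n).filter fun v => G.Reach j.toNat v).card : ℕ∞)

open scoped Classical in
/-- Add one to a profile at the levels in `P`. Negative indices are treated like level `0`, which is
immaterial for profiles that are infinite there. -/
noncomputable def addLevels (N : ℤ → ℕ∞) (P : ℕ → Prop) : ℤ → ℕ∞ :=
  fun j => N j + if P j.toNat then 1 else 0

theorem Graph.profile_zero (G : Graph) : G.profile 0 = halfLine := by
  funext j
  simp [Graph.profile, halfLine]

theorem Graph.profile_succ (G : Graph) (n : ℕ) :
    G.profile (n + 1) = addLevels (G.profile n) fun k => G.Reach k n := by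
  funext j
  unfold profile addLevels
  by_cases hj : j < 0
  · simp [hj]
  · simp only [hj, if_false]
    rw [Finset.range_add_one, Finset.filter_insert]
    split_ifs with h
    · rw [Finset.card_insert_of_notMem (by simp)]
      push_cast
      rfl
    · simp

theorem Graph.step_profile (G : Graph) (n : ℕ) (ξ : ℕ+) :
    step ξ (G.profile n) = addLevels (G.profile n) fun k =>
      ((ξ : ℕ) : ℕ∞) ≤ G.profile n ((k : ℤ) - 1) := by
  funext j
  unfold addLevels step
  by_cases hj : j < 0
  · simp [Graph.profile, hj]
  · have : ((j.toNat : ℕ) : ℤ) = j := by omega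
    simp only [this]

/-- A function of an initial segment of `{0, …, n}` containing `0` is an affine combination of the
indicators that `1, …, n` belong to the segment. Hence two random initial segments for which these
events have the same probabilities have the same law. -/
theorem eq_sum_of_initial (Φ : (ℕ → Prop) → ℝ) {P : ℕ → Prop} [DecidablePred P]
    (hP : ∀ k, P (k + 1) → P k) (h0 : P 0) {n : ℕ} (hn : ∀ k, P k → k ≤ n) :
    Φ P = Φ (fun k => k ≤ 0) + ∑ t ∈ Finset.range n,
      (Φ (fun k => k ≤ t + 1) - Φ (fun k => k ≤ t)) * if P (t + 1) then 1 else 0 := by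
  have hanti : ∀ k l, k ≤ l → P l → P k := by
    intro k l hkl
    induction hkl with
    | refl => exact id
    | step _ ih => exact fun h => ih (hP _ h)
  set τ := Nat.findGreatest P n with hτ
  have hτP : P τ := Nat.findGreatest_spec (Nat.zero_le n) h0
  have hiff : ∀ k, P k ↔ k ≤ τ := fun k =>
    ⟨fun h => Nat.le_findGreatest (hn k h) h, fun h => hanti _ _ h hτP⟩
  have e : P = fun k => k ≤ τ := funext fun k => propext (hiff k)
  have hfilter : (Finset.range n).filter (fun t => P (t + 1)) = Finset.range τ := by
    ext t
    have := hn _ hτP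
    simp only [Finset.mem_filter, Finset.mem_range, hiff]
    omega
  simp only [mul_ite, mul_one, mul_zero]
  rw [← Finset.sum_filter, hfilter, Finset.sum_range_sub (fun t => Φ fun k => k ≤ t)]
  conv_lhs => rw [e]
  ring

/-! ### Resampling the edges into new vertices -/

/-- `f` only depends on the edges among the vertices `0, …, n - 1`. -/
def DependsBelow {β : Type*} (n : ℕ) (f : Graph → β) : Prop :=
  ∀ G H : Graph, (∀ e, e.1.2 < n → G e = H e) → f G = f H

theorem DependsBelow.measurable {β : Type*} [MeasurableSpace β] {n : ℕ} {f : Graph → β}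
    (hf : DependsBelow n f) : Measurable f := by
  have hfin : Finite {e : {e : ℕ × ℕ // e.1 < e.2} // e.1.2 < n} := by
    refine Finite.of_injective (β := Fin n × Fin n)
      (fun e => (⟨e.1.1.1, e.1.2.trans e.2⟩, ⟨e.1.1.2, e.2⟩)) fun e e' h => ?_
    simp only [Prod.mk.injEq, Fin.mk.injEq] at h
    exact Subtype.ext (Subtype.ext (Prod.ext h.1 h.2))
  let r : Graph → ({e : {e : ℕ × ℕ // e.1 < e.2} // e.1.2 < n} → Bool) := fun G e => G e.1
  let x : ({e : {e : ℕ × ℕ // e.1 < e.2} // e.1.2 < n} → Bool) → Graph :=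
    fun g e => if h : e.1.2 < n then g ⟨e, h⟩ else false
  have e : f = (fun g => f (x g)) ∘ r := by
    funext G
    refine hf _ _ fun e he => ?_
    simp [x, r, he]
  rw [e]
  refine (measurable_of_finite _).comp ?_
  exact measurable_pi_iff.2 fun e => measurable_pi_apply e.1

/-- The graph whose edges among the first `n` vertices are those of `G`, the others being those
of `G'`. -/
def glue (n : ℕ) (G G' : Graph) : Graph := fun e => if e.1.2 < n then G e else G' e

/-- Independence of the edges among the first `n` vertices from the other edges. -/
theorem measurePreserving_glue (p : unitInterval) (n : ℕ) :
    MeasurePreserving (fun x : Graph × Graph => glue n x.1 x.2) ((law p).prod (law p)) (law p) := by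
  have hm : Measurable fun x : Graph × Graph => glue n x.1 x.2 := by
    refine measurable_pi_iff.2 fun e => ?_
    unfold glue
    split_ifs
    · exact (measurable_pi_apply e).comp measurable_fst
    · exact (measurable_pi_apply e).comp measurable_snd
  refine ⟨hm, ?_⟩
  refine Measure.eq_infinitePi _ fun s t ht => ?_
  rw [Measure.map_apply hm (MeasurableSet.pi s.countable_toSet fun i _ => ht i)]
  have e : (fun x : Graph × Graph => glue n x.1 x.2) ⁻¹' (Set.pi (s : Set _) t)
      = (Set.pi (s.filter fun e => e.1.2 < n : Finset _) t) ×ˢ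
        (Set.pi (s.filter fun e => ¬ e.1.2 < n : Finset _) t) := by
    ext x
    simp only [Set.mem_preimage, Set.mem_pi, Set.mem_prod, Finset.coe_filter, Finset.mem_coe,
      Set.mem_ofPred_eq, glue]
    constructor
    · intro h
      refine ⟨fun i hi => ?_, fun i hi => ?_⟩
      · simpa [hi.2] using h i hi.1
      · simpa [hi.2] using h i hi.1
    · rintro ⟨h1, h2⟩ i hi
      split_ifs with h
      · exact h1 i ⟨hi, h⟩
      · exact h2 i ⟨hi, h⟩
  rw [e, Measure.prod_prod, law, Measure.infinitePi_pi _ fun i _ => ht i,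
    Measure.infinitePi_pi _ fun i _ => ht i, Finset.prod_filter_mul_prod_filter_not]

theorem edge_congr {G H : Graph} {u v : ℕ} (h : ∀ e, e.1.2 = v → G e = H e) :
    G.Edge u v ↔ H.Edge u v :=
  exists_congr fun huv => by rw [h _ rfl]

theorem reach_congr {G H : Graph} {n : ℕ} (h : ∀ e, e.1.2 < n → G e = H e) {k v : ℕ}
    (hv : v < n) : G.Reach k v ↔ H.Reach k v := by
  induction k generalizing v with
  | zero => exact Iff.rfl
  | succ k ih =>
    refine exists_congr fun u => ?_
    rw [edge_congr (H := H) fun e he => h e (he ▸ hv)]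
    exact and_congr_right fun hu => ih (hu.lt.trans hv)

theorem dependsBelow_profile (n : ℕ) : DependsBelow n fun G => G.profile n := by
  classical
  intro G H h
  funext j
  simp only [Graph.profile]
  split_ifs
  · rfl
  · rw [Finset.filter_congr fun v hv => reach_congr h (Finset.mem_range.1 hv)]

theorem glue_eq_left {n : ℕ} {G G' : Graph} : ∀ e, e.1.2 < n → glue n G G' e = G e :=
  fun _ he => if_pos he

theorem reach_glue_succ (n : ℕ) (G G' : Graph) (t : ℕ) :
    (glue n G G').Reach (t + 1) n ↔ ∃ u, G'.Edge u n ∧ G.Reach t u := by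
  refine exists_congr fun u => ?_
  rw [edge_congr (G := glue n G G') (H := G') fun e he => if_neg (by omega)]
  exact and_congr_right fun hu => reach_congr glue_eq_left hu.lt

theorem law_real_exists_edge (p : unitInterval) {n : ℕ} {S : Finset ℕ} (hS : ∀ u ∈ S, u < n) :
    (law p).real {G | ∃ u ∈ S, G.Edge u n} = 1 - (1 - (p : ℝ)) ^ S.card := by
  classical
  let ι : S ↪ {e : ℕ × ℕ // e.1 < e.2} :=
    ⟨fun u => ⟨(u.1, n), hS u.1 u.2⟩, fun u v h =>
      Subtype.ext (congrArg (fun e : {e : ℕ × ℕ // e.1 < e.2} => e.1.1) h)⟩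
  have hc : {G : Graph | ∃ u ∈ S, G.Edge u n}ᶜ
      = Set.pi (Finset.univ.map ι : Finset _) fun _ => {false} := by
    ext G
    simp only [Set.mem_compl_iff, Set.mem_ofPred_eq, not_exists, not_and, Set.mem_pi,
      Finset.coe_map, Set.mem_image, Set.mem_singleton_iff, Graph.Edge]
    constructor
    · rintro h _ ⟨u, -, rfl⟩
      exact eq_false_of_ne_true (h u.1 u.2 (hS u.1 u.2))
    · intro h u hu hun
      exact ne_true_of_eq_false (h (ι ⟨u, hu⟩) ⟨⟨u, hu⟩, by simp, rfl⟩)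
  have hmeas : MeasurableSet {G : Graph | ∃ u ∈ S, G.Edge u n}ᶜ := by
    rw [hc]
    exact MeasurableSet.pi (Finset.countable_toSet _) fun _ _ => MeasurableSet.of_discrete
  have h1 : (law p).real {G : Graph | ∃ u ∈ S, G.Edge u n}ᶜ = (1 - (p : ℝ)) ^ S.card := by
    rw [hc, measureReal_def, law, Measure.infinitePi_pi _ fun _ _ => MeasurableSet.of_discrete,
      ENNReal.toReal_prod]
    have : ∀ e ∈ Finset.univ.map ι, (bernoulliMeasure true false p {false}).toReal = 1 - (p : ℝ) := by
      intro e _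
      rw [← measureReal_def, bernoulliMeasure_real_apply_of_notMem_of_mem] <;> simp
    rw [Finset.prod_congr rfl this]
    simp
  rw [← h1, probReal_compl_eq_one_sub hmeas.of_compl]
  ring

/-! ### The law of the profile of a random graph -/

theorem avg_indicator_le (p : ℝ) (c : ℕ) :
    avg p (fun ξ => if ((ξ : ℕ) : ℕ∞) ≤ (c : ℕ∞) then 1 else 0) = 1 - (1 - p) ^ c := by
  unfold avg
  rw [← Equiv.pnatEquivNat.symm.tsum_eq]
  have e : ∀ k : ℕ, p * (1 - p) ^ (((Equiv.pnatEquivNat.symm k : ℕ+) : ℕ) - 1) *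
      (if (((Equiv.pnatEquivNat.symm k : ℕ+) : ℕ) : ℕ∞) ≤ (c : ℕ∞) then (1 : ℝ) else 0)
      = if k ∈ Finset.range c then p * (1 - p) ^ k else 0 := by
    intro k
    have : (((Equiv.pnatEquivNat.symm k : ℕ+) : ℕ)) = k + 1 := rfl
    simp only [this, Nat.cast_le, Nat.add_sub_cancel, Finset.mem_range, Nat.succ_le_iff]
    split_ifs <;> simp
  simp only [e]
  rw [tsum_eq_sum (s := Finset.range c) fun k hk => if_neg hk]
  rw [Finset.sum_congr rfl fun k hk => if_pos hk, ← Finset.mul_sum]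
  have := mul_neg_geom_sum (1 - p) c
  rwa [sub_sub_cancel] at this

theorem avg_add_sum {p : ℝ} (h0 : 0 < p) (h1 : p ≤ 1) (a : ℝ) (n : ℕ) (c : ℕ → ℝ)
    (g : ℕ → ℕ+ → ℝ) (hg : ∀ t ξ, |g t ξ| ≤ 1) :
    avg p (fun ξ => a + ∑ t ∈ Finset.range n, c t * g t ξ)
      = a + ∑ t ∈ Finset.range n, c t * avg p (g t) := by
  induction n with
  | zero => simp [avg_const a h0 h1]
  | succ n ih =>
    simp only [Finset.sum_range_succ, ← add_assoc]
    rw [avg_add (B := |a| + ∑ t ∈ Finset.range n, |c t|) (B' := |c n|) _ _ h0 h1, ih, avg_mul_left]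
    · intro ξ
      refine (abs_add_le _ _).trans (add_le_add le_rfl ((Finset.abs_sum_le_sum_abs _ _).trans ?_))
      refine Finset.sum_le_sum fun t _ => ?_
      rw [abs_mul]
      exact mul_le_of_le_one_right (abs_nonneg _) (hg t ξ)
    · intro ξ
      rw [abs_mul]
      exact mul_le_of_le_one_right (abs_nonneg _) (hg n ξ)

open scoped Classical in
/-- Given the first `n` vertices, adding a vertex is a geometric move. If `c` vertices end a path of
length `t`, then the new vertex ends a path of length `t + 1` with probability `1 - (1 - p) ^ c`, which
is the probability that a geometric letter is at most `c`. -/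
theorem integral_glue_eq_avg {p : unitInterval} (h0 : 0 < (p : ℝ)) (F : (ℤ → ℕ∞) → ℝ)
    (G : Graph) (n : ℕ) :
    ∫ G', F ((glue n G G').profile (n + 1)) ∂law p
      = avg p fun ξ => F (step ξ (G.profile n)) := by
  set Φ : (ℕ → Prop) → ℝ := fun P => F (addLevels (G.profile n) P) with hΦ
  set S : ℕ → Finset ℕ := fun t => (Finset.range n).filter fun v => G.Reach t v with hS
  have hprof : ∀ t : ℕ, G.profile n (((t + 1 : ℕ) : ℤ) - 1) = ((S t).card : ℕ∞) := by
    intro t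
    simp [Graph.profile, hS]
  have hr : ∀ G' t, (glue n G G').Reach (t + 1) n ↔ ∃ u ∈ S t, G'.Edge u n := by
    intro G' t
    rw [reach_glue_succ]
    refine exists_congr fun u => ?_
    simp only [hS, Finset.mem_filter, Finset.mem_range]
    exact ⟨fun h => ⟨⟨h.1.lt, h.2⟩, h.1⟩, fun h => ⟨h.2, h.1.2⟩⟩
  have hL : ∀ G', F ((glue n G G').profile (n + 1)) = Φ (fun k => k ≤ 0) +
      ∑ t ∈ Finset.range n, (Φ (fun k => k ≤ t + 1) - Φ (fun k => k ≤ t)) *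
        if ∃ u ∈ S t, G'.Edge u n then 1 else 0 := by
    intro G'
    have e : (glue n G G').profile n = G.profile n := dependsBelow_profile n _ _ glue_eq_left
    have := eq_sum_of_initial Φ (P := fun k => (glue n G G').Reach k n) (n := n)
      (fun k h => h.of_succ) trivial fun k h => h.le
    simp only [hr] at this
    rw [Graph.profile_succ, e]
    exact this
  have hR : ∀ ξ : ℕ+, F (step ξ (G.profile n)) = Φ (fun k => k ≤ 0) +
      ∑ t ∈ Finset.range n, (Φ (fun k => k ≤ t + 1) - Φ (fun k => k ≤ t)) *
        if ((ξ : ℕ) : ℕ∞) ≤ ((S t).card : ℕ∞) then 1 else 0 := by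
    intro ξ
    have hS0 : ∀ t, n ≤ t → S t = ∅ := fun t ht => by
      refine Finset.filter_eq_empty_iff.2 fun v hv hr => ?_
      have := hr.le
      have := Finset.mem_range.1 hv
      omega
    have := eq_sum_of_initial Φ (P := fun k => ((ξ : ℕ) : ℕ∞) ≤ G.profile n ((k : ℤ) - 1)) (n := n)
      (fun k h => ?_) (by simp [Graph.profile]) (fun k h => ?_)
    · simp only [hprof] at this
      rw [Graph.step_profile]
      exact this
    · rcases k with _ | k
      · simp [Graph.profile]
      · rw [hprof] at h ⊢
        refine h.trans (Nat.cast_le.2 (Finset.card_le_card fun v hv => ?_))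
        simp only [hS, Finset.mem_filter] at hv ⊢
        exact ⟨hv.1, hv.2.of_succ⟩
    · rcases k with _ | k
      · exact Nat.zero_le n
      · rw [hprof] at h
        by_contra hlt
        rw [hS0 k (by omega)] at h
        simp at h
  have hmeas : ∀ t, MeasurableSet {G' : Graph | ∃ u ∈ S t, G'.Edge u n} := fun t => by
    have : DependsBelow (n + 1) fun G' : Graph => ∃ u ∈ S t, G'.Edge u n := by
      intro H H' hH
      simp only [edge_congr (G := H) (H := H') (v := n) fun e he => hH e (by omega)]
    exact measurableSet_setOfPred.2 this.measurable
  have hint : ∀ t, ∫ G', (if ∃ u ∈ S t, G'.Edge u n then (1 : ℝ) else 0) ∂law p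
      = 1 - (1 - (p : ℝ)) ^ (S t).card := fun t => by
    rw [← law_real_exists_edge p (S := S t) (n := n) fun u hu => by
      simp only [hS, Finset.mem_filter, Finset.mem_range] at hu; exact hu.1]
    rw [← integral_indicator_one (hmeas t)]
    refine integral_congr_ae (Eventually.of_forall fun G' => ?_)
    simp [Set.indicator_apply]
  have hi : ∀ t, Integrable (fun G' : Graph => if ∃ u ∈ S t, G'.Edge u n then (1 : ℝ) else 0)
      (law p) := fun t =>
    ((integrable_const (1 : ℝ)).indicator (hmeas t)).congr
      (Eventually.of_forall fun G' => by simp [Set.indicator_apply])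
  simp only [hL, hR]
  rw [integral_add (integrable_const _) (integrable_finsetSum _ fun t _ => (hi t).const_mul _),
    integral_finsetSum _ fun t _ => (hi t).const_mul _, avg_add_sum h0 p.2.2]
  · simp only [integral_const_mul, hint, avg_indicator_le, integral_const, probReal_univ,
      one_smul]
  · intro t ξ
    split_ifs <;> simp

theorem integral_profile_succ {p : unitInterval} (h0 : 0 < (p : ℝ)) {F : (ℤ → ℕ∞) → ℝ} {B : ℝ}
    (hF : ∀ N, |F N| ≤ B) (n : ℕ) :
    ∫ G, F (Graph.profile G (n + 1)) ∂law p
      = ∫ G, avg p (fun ξ => F (step ξ (Graph.profile G n))) ∂law p := by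
  have hm : Measurable fun G : Graph => F (G.profile (n + 1)) :=
    DependsBelow.measurable (n := n + 1) fun G H h => by
      rw [show G.profile (n + 1) = H.profile (n + 1) from dependsBelow_profile _ _ _ h]
  have hp := measurePreserving_glue p n
  have hi : Integrable (fun x : Graph × Graph => F ((glue n x.1 x.2).profile (n + 1)))
      ((law p).prod (law p)) :=
    Integrable.of_bound (hm.comp hp.measurable).aestronglyMeasurable B
      (Eventually.of_forall fun x => hF _)
  have h1 := integral_map (μ := (law p).prod (law p)) hp.measurable.aemeasurable hm.aestronglyMeasurable
  rw [hp.map_eq] at h1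
  rw [h1, integral_prod _ hi]
  simp only [integral_glue_eq_avg h0]

/-- The profile of the Barak–Erdős graph on `n` vertices has the law of the profile obtained from
`halfLine` by `n` geometric moves. -/
theorem integral_profile {p : unitInterval} (h0 : 0 < (p : ℝ)) {F : (ℤ → ℕ∞) → ℝ} {B : ℝ}
    (hF : ∀ N, |F N| ≤ B) (n : ℕ) :
    ∫ G, F (Graph.profile G n) ∂law p = wordAvg p n fun α => F (run halfLine α) := by
  induction n generalizing F with
  | zero => simp [Graph.profile_zero, wordAvg]
  | succ n ih =>
    rw [integral_profile_succ h0 hF,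
      ih (F := fun N => avg p fun ξ => F (step ξ N)) fun N =>
        abs_avg_le (fun ξ => hF _) h0 p.2.2, wordAvg_succ']
    simp only [run_append, run_cons, run_nil]

/-! ### Almost sure convergence -/

theorem Graph.levelCount_profile (G : Graph) {n : ℕ} (hn : 0 < n) :
    levelCount (G.profile n) = G.longestPath n + 1 := by
  classical
  have e : {k : ℕ | G.profile n k = 0} = Set.Ici (G.longestPath n + 1) := by
    ext k
    have hk : G.profile n k = (((Finset.range n).filter fun v => G.Reach k v).card : ℕ∞) := by
      have : ¬ ((k : ℤ) < 0) := by omega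
      simp only [Graph.profile, if_neg this, Int.toNat_natCast]
    rw [Set.mem_ofPred_eq, Set.mem_Ici, Nat.succ_le_iff, ← not_iff_not, not_lt,
      ← G.hasPath_iff_le_longestPath hn, G.hasPath_iff, hk]
    simp [Finset.filter_eq_empty_iff]
  rw [levelCount, e, csInf_Ici]

/-- Chebyshev's inequality. The front has moved by `longestPath + 1`, since the first vertex already
moves it from `-1` to `0`. -/
theorem law_real_deviation_le {p : unitInterval} (h0 : 0 < (p : ℝ)) {n : ℕ} (hn : 0 < n) {t : ℝ}
    (ht : 0 < t) :
    (law p).real {G | t ≤ |(G.longestPath n : ℝ) + 1 - meanFront p n|} ≤ n / t ^ 2 := by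
  classical
  set c := meanFront p n with hc
  set F : (ℤ → ℕ∞) → ℝ := fun N => if t ≤ |(levelCount N : ℝ) - c| then 1 else 0 with hF
  have hFB : ∀ N, |F N| ≤ 1 := fun N => by
    rw [hF]; simp only; split_ifs <;> simp
  have hset : {G : Graph | t ≤ |(G.longestPath n : ℝ) + 1 - c|}
      = {G : Graph | t ≤ |(levelCount (G.profile n) : ℝ) - c|} := by
    ext G
    simp only [Set.mem_ofPred_eq, G.levelCount_profile hn, Nat.cast_add, Nat.cast_one]
  have hmeas : MeasurableSet {G : Graph | t ≤ |(levelCount (G.profile n) : ℝ) - c|} := by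
    have : DependsBelow n fun G : Graph => t ≤ |(levelCount (G.profile n) : ℝ) - c| := by
      intro G H h
      simp only [show G.profile n = H.profile n from dependsBelow_profile _ _ _ h]
    exact measurableSet_setOfPred.2 this.measurable
  have h1 : (law p).real {G : Graph | t ≤ |(levelCount (G.profile n) : ℝ) - c|}
      = wordAvg p n fun α => F (run halfLine α) := by
    rw [← integral_profile h0 hFB, ← integral_indicator_one hmeas]
    refine integral_congr_ae (Eventually.of_forall fun G => ?_)
    simp [Set.indicator_apply, hF]
  have hvar := wordAvg_frontCount_variance_le h0 p.2.2 n
  rw [hset, h1]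
  have b : BddAt n (fun α => (1 / t ^ 2) * ((frontCount α : ℝ) - c) ^ 2)
      (1 / t ^ 2 * (n + |c|) ^ 2) := fun α hα => by
    rw [abs_mul, abs_pow, abs_of_nonneg (by positivity : 0 ≤ 1 / t ^ 2)]
    gcongr
    exact (abs_sub _ _).trans (by gcongr; exact bddAt_frontCount n α hα)
  calc wordAvg p n (fun α => F (run halfLine α))
      ≤ wordAvg p n fun α => (1 / t ^ 2) * ((frontCount α : ℝ) - c) ^ 2 := by
        refine wordAvg_mono (fun α _ => hFB _) b (fun α _ => ?_) h0 p.2.2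
        have hFα : F (run halfLine α) = if t ≤ |(frontCount α : ℝ) - c| then 1 else 0 := rfl
        rw [hFα]
        split_ifs with h
        · rw [one_div, ← div_eq_inv_mul, one_le_div (by positivity), ← sq_abs (_ - c)]
          gcongr
        · positivity
    _ = 1 / t ^ 2 * wordAvg p n fun α => ((frontCount α : ℝ) - c) ^ 2 := wordAvg_mul_left _
    _ ≤ 1 / t ^ 2 * n := by gcongr; exact hvar
    _ = n / t ^ 2 := by ring

theorem ae_eventually_deviation_lt {p : unitInterval} (h0 : 0 < (p : ℝ)) {ε : ℝ} (hε : 0 < ε) :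
    ∀ᵐ G ∂law p, ∀ᶠ k : ℕ in atTop,
      |(Graph.longestPath G ((k + 1) ^ 2) : ℝ) + 1 - meanFront p ((k + 1) ^ 2)|
        < ε * ((k + 1 : ℕ) : ℝ) ^ 2 := by
  set s : ℕ → Set Graph := fun k => {G | ε * ((k + 1 : ℕ) : ℝ) ^ 2 ≤
    |(Graph.longestPath G ((k + 1) ^ 2) : ℝ) + 1 - meanFront p ((k + 1) ^ 2)|} with hs
  have hle : ∀ k, law p (s k) ≤ ENNReal.ofReal ((1 / ε ^ 2) * (1 / ((k + 1 : ℕ) : ℝ) ^ 2)) := by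
    intro k
    rw [← ofReal_measureReal]
    refine ENNReal.ofReal_le_ofReal ?_
    refine (law_real_deviation_le h0 (by positivity) (by positivity)).trans_eq ?_
    push_cast
    field_simp
  have hsum : Summable fun k : ℕ => (1 / ε ^ 2) * (1 / ((k + 1 : ℕ) : ℝ) ^ 2) :=
    ((summable_nat_add_iff 1).2 (Real.summable_one_div_nat_pow.2 one_lt_two)).mul_left _
  have hfin : ∑' k, law p (s k) ≠ ⊤ :=
    ne_top_of_le_ne_top hsum.tsum_ofReal_ne_top (ENNReal.tsum_le_tsum hle)
  filter_upwards [ae_eventually_notMem hfin] with G hG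
  filter_upwards [hG] with k hk
  exact not_le.1 hk

/-- The deviation bound is summable along the squares, and `longestPath` is monotone in `n`. -/
theorem ae_tendsto_longestPath {p : unitInterval} (h0 : 0 < (p : ℝ)) {c : ℝ}
    (hc : Tendsto (fun n : ℕ => meanFront p n / n) atTop (𝓝 c)) :
    ∀ᵐ G ∂law p, Tendsto (fun n : ℕ => (Graph.longestPath G n : ℝ) / n) atTop (𝓝 c) := by
  have hae : ∀ᵐ G ∂law p, ∀ j : ℕ, ∀ᶠ k : ℕ in atTop,
      |(Graph.longestPath G ((k + 1) ^ 2) : ℝ) + 1 - meanFront p ((k + 1) ^ 2)|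
        < (1 / ((j : ℝ) + 1)) * ((k + 1 : ℕ) : ℝ) ^ 2 :=
    ae_all_iff.2 fun j => ae_eventually_deviation_lt h0 (by positivity)
  filter_upwards [hae] with G hG
  have hsq : Tendsto (fun k : ℕ => (k + 1) ^ 2) atTop atTop :=
    (tendsto_pow_atTop two_ne_zero).comp (tendsto_add_atTop_nat 1)
  refine tendsto_div_of_monotone_of_exists_subseq_tendsto_div _ _
    (fun n m h => Nat.cast_le.2 (G.monotone_longestPath h)) fun a ha =>
      ⟨fun k => (k + 1) ^ 2, ?_, hsq, ?_⟩
  · have h1 : Tendsto (fun k : ℕ => ((1 : ℝ) + 1 / ((k : ℝ) + 1)) ^ 2) atTop (𝓝 ((1 + 0) ^ 2)) :=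
      (tendsto_const_nhds.add tendsto_one_div_add_atTop_nhds_zero_nat).pow 2
    rw [add_zero, one_pow] at h1
    filter_upwards [h1.eventually (gt_mem_nhds ha)] with k hk
    have hk0 : (0 : ℝ) < (k : ℝ) + 1 := by positivity
    have e : ((1 : ℝ) + 1 / ((k : ℝ) + 1)) * ((k : ℝ) + 1) = (k : ℝ) + 1 + 1 := by
      field_simp
    push_cast
    rw [← e, mul_pow]
    gcongr
  · have h1 := hc.comp hsq
    have h2 : Tendsto (fun k : ℕ => ((Graph.longestPath G ((k + 1) ^ 2) : ℝ) + 1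
        - meanFront p ((k + 1) ^ 2)) / (((k + 1) ^ 2 : ℕ) : ℝ)) atTop (𝓝 0) := by
      rw [Metric.tendsto_atTop']
      intro ε hε
      obtain ⟨j, hj⟩ := exists_nat_one_div_lt hε
      obtain ⟨K, hK⟩ := eventually_atTop.1 (hG j)
      refine ⟨K, fun k hk => ?_⟩
      have hpos : (0 : ℝ) < (((k + 1) ^ 2 : ℕ) : ℝ) := by positivity
      rw [Real.dist_eq, sub_zero, abs_div, abs_of_pos hpos, div_lt_iff₀ hpos]
      refine (hK k hk.le).trans ?_
      push_cast
      gcongr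
    have h3 : Tendsto (fun k : ℕ => (1 : ℝ) / (((k + 1) ^ 2 : ℕ) : ℝ)) atTop (𝓝 0) :=
      tendsto_one_div_atTop_nhds_zero_nat.comp hsq
    have h4 := (h2.add h1).sub h3
    rw [zero_add, sub_zero] at h4
    refine h4.congr fun k => ?_
    simp only [Function.comp]
    ring

theorem law_zero : law 0 = Measure.dirac fun _ => false := by
  simp only [law, bernoulliMeasure_zero]
  exact Measure.infinitePi_dirac _

theorem longestPath_false (n : ℕ) : Graph.longestPath (fun _ => false) n = 0 := by
  refine Nat.le_zero.1 (csSup_le' ?_)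
  intro k hk
  obtain ⟨v, -, hr⟩ := (Graph.hasPath_iff _ _ _).1 hk
  rcases k with _ | k
  · exact le_rfl
  · obtain ⟨u, ⟨_, h⟩, -⟩ := hr
    exact absurd h (by simp)

theorem ae_tendsto_longestPath_zero :
    ∀ᵐ G ∂law 0, Tendsto (fun n : ℕ => (Graph.longestPath G n : ℝ) / n) atTop (𝓝 0) := by
  rw [law_zero]
  have hm : ∀ s : Set Graph, (fun _ => false) ∈ s → ∀ᵐ G ∂Measure.dirac (fun _ => false), G ∈ s := by
    intro s hs
    rw [ae_dirac_eq]
    exact hs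
  refine hm {G | Tendsto (fun n : ℕ => (Graph.longestPath G n : ℝ) / n) atTop (𝓝 0)} ?_
  simp [longestPath_false]

end BarakErdos

theorem theorem3 :
    ∃ C : ℝ → ℝ,
      (∀ p : unitInterval, ∀ᵐ G ∂BarakErdos.law p,
        Tendsto (fun n : ℕ => (G.longestPath n : ℝ) / (n : ℝ)) atTop (𝓝 (C p))) ∧
      AnalyticOn ℝ C (Set.Ioc (1 / 2) 1) ∧
      ∀ X : InfiniteBin.Config, InfiniteBin.Admissible X →
        ∀ p ∈ Set.Ioc ((3 - √2) / 2) 1,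
          HasSum (fun k : ℕ => (InfiniteBin.coeff X k : ℝ) * (1 - p) ^ k) (C p) := by
  have hlim : ∀ p : ℝ, ∃ c : ℝ, (0 < p → p ≤ 1 →
      Tendsto (fun n : ℕ => InfiniteBin.meanFront p n / n) atTop (𝓝 c)) ∧ (p = 0 → c = 0) := by
    intro p
    by_cases hp : 0 < p ∧ p ≤ 1
    · obtain ⟨c, hc⟩ := InfiniteBin.exists_tendsto_meanFront hp.1 hp.2
      exact ⟨c, fun _ _ => hc, fun h => absurd hp.1 (by simp [h])⟩
    · exact ⟨0, fun h0 h1 => absurd ⟨h0, h1⟩ hp, fun _ => rfl⟩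
  choose C hC hC0 using hlim
  have hsum : ∀ X, InfiniteBin.Admissible X → ∀ p, 1 / 2 < p → p ≤ 1 →
      C p = InfiniteBin.signSum X p := fun X hX p hp h1 =>
    tendsto_nhds_unique (hC p (by linarith) h1) (InfiniteBin.tendsto_meanFront hX hp h1)
  refine ⟨C, fun p => ?_, ?_, fun X hX p hp => ?_⟩
  · rcases p.2.1.eq_or_lt with h | h
    · obtain rfl : p = 0 := Subtype.ext h.symm
      rw [hC0 ((0 : unitInterval) : ℝ) rfl]
      exact BarakErdos.ae_tendsto_longestPath_zero
    · exact BarakErdos.ae_tendsto_longestPath h (hC p h p.2.2)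
  · exact (InfiniteBin.analyticOn_signSum InfiniteBin.admissible_halfLine).congr fun p hp =>
      hsum _ InfiniteBin.admissible_halfLine p hp.1 hp.2
  · have h2 : √2 ^ 2 = 2 := Real.sq_sqrt (by norm_num)
    have h1 : 1 ≤ √2 := Real.one_le_sqrt.2 (by norm_num)
    have h3 : √2 < 2 := by nlinarith
    rw [hsum X hX p (by linarith [hp.1]) hp.2]
    -- `θ = √2 + 1` is the reciprocal of twice the radius of convergence `(√2 - 1) / 2`; for this
    -- choice both sides of the required inequality agree at the radius.
    refine InfiniteBin.hasSum_coeff hX (θ := √2 + 1) hp.2 (by linarith) ?_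
    nlinarith [hp.1]
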